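/- Let $\zeta\ge 1$, let $d(x)=L_\zeta^{-1}e^{-|x|^\zeta/\zeta}$ with $L_\zeta=\int_{\mathbb R}e^{-|x|^\zeta/\zeta}\,dx$ be the $\zeta$-Subbotin density, $\overline D(u)=\int_u^\infty d(x)\,dx$ its upper tail and $\overline D^{-1}:(0,1)\to\mathbb R$ the inverse of $\overline D$. Let $m\ge 2$, and let $(X_i,H_i)\in\mathbb R\times\{0,1\}$, $1\le i\le m+1$, be i.i.d. with $\pi_{0,m}=P(H_1=0)$, $\pi_{1,m}=P(H_1=1)=1-\pi_{0,m}$ and $\tau_m=\pi_{0,m}/\pi_{1,m}\in(1,\infty)$. Conditionally on $H_1=0$, $X_1$ has density $d$. Conditionally on $H_1=1$, it has density $d(x-\mu_m)$ with $\mu_m>0$ (location model, where $\zeta>1$ is assumed) or $d(x/\sigma_m)/\sigma_m$ with $\sigma_m>1$ (scale model, $\zeta\ge1$). Put $p_i=\overline D(X_i)$ (location) or $p_i=2\overline D(|X_i|)$ (scale). Let $F_m$ be the c.d.f. of $p_1$ conditionally on $H_1=1$, let $f_m=F_m'$ on $(0,1)$ and $\Psi_m(t)=F_m(t)/t$ on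 $(0,1)$; both $f_m$ and $\Psi_m$ are decreasing on $(0,1)$. For a threshold $\hat t_m$ (a measurable function of $p_1,\dots,p_m$ with values in $[0,1]$), which assigns label $1$ to the $p$-values that are at most $\hat t_m$, let $R_m(\hat t_m)$ denote either the transductive risk $m^{-1}\sum_{i=1}^m\{P(p_i\le\hat t_m,H_i=0)+P(p_i>\hat t_m,H_i=1)\}$ or the inductive risk $P(p_{m+1}\le\hat t_m,H_{m+1}=0)+P(p_{m+1}>\hat t_m,H_{m+1}=1)$. All that follows holds for each of the two risks. Let $t_m^B=f_m^{-1}(\tau_m)\in(0,1)$ be the Bayes threshold, $C_m=F_m(t_m^B)\in(0,1)$ its power and $q_m^{\mathrm{opt}}=\tau_m^{-1}\Psi_m(t_m^B)=C_m/(\tau_m t_m^B)\ge 1$ the optimal recovery parameter. In the location model let $$r_m=\bigl(\zeta\log\tau_m+|\overline D^{-1}(C_m)|^\zeta\bigr)^{1-1/\zeta},\qquad K_m=d(0),$$ and in the scale model let $$r_m=\zeta\log\tau_m+\bigl(\overline D^{-1}(C_m/2)\bigr)^\zeta,\qquad K_m=2\,\overline D^{-1}(C_m/2)\,d\bigl(\overline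 D^{-1}(C_m/2)\bigr).$$ Let $\alpha_m\in(0,1/2)$, $q_m=\alpha_m^{-1}-1$ and $\nu\in(0,1)$. Then: (i) If $r_m\ge\frac{K_m}{C_m(1-\nu)}\bigl(\log(q_m/q_m^{\mathrm{opt}})-\log\nu\bigr)$, the BFDR threshold $t_m^\star=\Psi_m^{-1}(q_m\tau_m)\in(0,1)$ at level $\alpha_m$ satisfies $$R_m(t_m^\star)-R_m(t_m^B)\le\pi_{1,m}\left\{\left(\frac{C_m}{q_m}-\frac{C_m}{q_m^{\mathrm{opt}}}\right)\vee\left(K_m\frac{\log(q_m/q_m^{\mathrm{opt}})-\log\nu}{r_m}\right)\right\}.$$ (ii) Let $\varepsilon\in(0,1)$, $D_{1,m}=-\log(\nu\pi_{0,m}(1-\varepsilon))$ and $D_{2,m}=\log(\nu^{-1}C_m\tau_m^{-1}m)$. Let $\hat t_m^{\mathrm{FDR}}=\hat t_m^{\mathrm{BH}}\vee(\alpha_m/m)$ be the FDR threshold at level $\alpha_m$, where $\hat t_m^{\mathrm{BH}}=\max\{t\in[0,1]:\widehat{\mathbb G}_m(t)\ge t/\alpha_m\}$ and $\widehat{\mathbb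 G}_m(t)=m^{-1}\#\{i\le m:p_i\le t\}$. For each $a\in\{1,2\}$, if $r_m\ge\frac{K_m}{C_m(1-\nu)}\bigl(\log(\alpha_m^{-1}/q_m^{\mathrm{opt}})+D_{a,m}\bigr)$, then $$R_m(\hat t_m^{\mathrm{FDR}})-R_m(t_m^B)\le\pi_{1,m}\left(\frac{\alpha_m}{1-\alpha_m}+K_m\frac{\bigl(\log(\alpha_m^{-1}/q_m^{\mathrm{opt}})+D_{a,m}\bigr)_+}{r_m}\right)+\frac{\alpha_m/m}{(1-\alpha_m)^2}+\pi_{1,m}\mathbf 1\{a=1\}\,e^{-m(\tau_m+1)^{-1}\nu\varepsilon^2C_m/4}.$$ -/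

import Mathlib

open MeasureTheory ProbabilityTheory Set

noncomputable section

namespace SubbotinFDR

/-- Normalising constant `L_ζ = ∫ exp (-|x|^ζ / ζ) dx`. -/
def normConst (ζ : ℝ) : ℝ := ∫ x : ℝ, Real.exp (-(|x| ^ ζ / ζ))

/-- The `ζ`-Subbotin density `d`. -/
def density (ζ x : ℝ) : ℝ := (normConst ζ)⁻¹ * Real.exp (-(|x| ^ ζ / ζ))

/-- The upper-tail function `D̄(u) = ∫_u^∞ d(x) dx`. -/
def upperTail (ζ u : ℝ) : ℝ := ∫ x in Ioi u, density ζ x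

/-- The inverse `D̄⁻¹` of the upper-tail function, meaningful on `(0,1)`. -/
def upperTailInv (ζ : ℝ) : ℝ → ℝ := Function.invFun (upperTail ζ)

/-- The alternative distribution is a shift or a dilation of the null distribution. -/
inductive ModelKind where
  | location : ModelKind
  | scale : ModelKind

/-- Parameters of a two-group Subbotin model: shape `ζ`, sparsity `τ = π₀ / π₁`, and
`θ`, which is the location parameter `μ` or the scale parameter `σ`. -/
structure Model where
  kind : ModelKind
  ζ : ℝ
  τ : ℝ
  θ : ℝ

namespace Model

/-- The parameter range: `τ > 1`, and `ζ > 1`, `μ > 0` (location) or `ζ ≥ 1`, `σ > 1` (scale). -/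
def Admissible (M : Model) : Prop :=
  1 < M.τ ∧
    match M.kind with
    | .location => 1 < M.ζ ∧ 0 < M.θ
    | .scale => 1 ≤ M.ζ ∧ 1 < M.θ

/-- `π₀ = P(H = 0)`; together with `π₁` it solves `π₀ + π₁ = 1`, `π₀ / π₁ = τ`. -/
def prob0 (M : Model) : ℝ := M.τ / (1 + M.τ)

/-- `π₁ = P(H = 1)`. -/
def prob1 (M : Model) : ℝ := 1 / (1 + M.τ)

/-- The density of an observation with label `1`. -/
def altDensity (M : Model) (x : ℝ) : ℝ :=
  match M.kind with
  | .location => density M.ζ (x - M.θ)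
  | .scale => density M.ζ (x / M.θ) / M.θ

/-- The law of an observation with label `0`. -/
def nullLaw (M : Model) : Measure ℝ :=
  volume.withDensity fun x => ENNReal.ofReal (density M.ζ x)

/-- The law of an observation with label `1`. -/
def altLaw (M : Model) : Measure ℝ :=
  volume.withDensity fun x => ENNReal.ofReal (M.altDensity x)

/-- The joint law of an observation and its label; `false` is label `0`, `true` is label `1`. -/
def pairLaw (M : Model) : Measure (ℝ × Bool) :=
  ENNReal.ofReal M.prob0 • M.nullLaw.map (fun x => (x, false)) +
    ENNReal.ofReal M.prob1 • M.altLaw.map (fun x => (x, true))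

/-- The `p`-value of an observation: `D̄(x)` (location), `2 D̄(|x|)` (scale). -/
def pValue (M : Model) (x : ℝ) : ℝ :=
  match M.kind with
  | .location => upperTail M.ζ x
  | .scale => 2 * upperTail M.ζ |x|

/-- `F(t)`, the c.d.f. of a `p`-value conditionally on label `1`. -/
def altCDF (M : Model) (t : ℝ) : ℝ := M.altLaw.real {x | M.pValue x ≤ t}

/-- The Bayes threshold `t^B = f⁻¹(τ) ∈ (0,1)`, where `f = F'`. -/
def bayesThreshold (M : Model) : ℝ :=
  Function.invFunOn (deriv M.altCDF) (Ioo 0 1) M.τ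

/-- The power `C = F(t^B)` of the Bayes procedure. -/
def bayesPower (M : Model) : ℝ := M.altCDF M.bayesThreshold

/-- `Ψ(t) = F(t) / t`. -/
def psi (M : Model) (t : ℝ) : ℝ := M.altCDF t / t

/-- The optimal recovery parameter `q^opt = τ⁻¹ Ψ(f⁻¹(τ))`. -/
def qOpt (M : Model) : ℝ := M.τ⁻¹ * M.psi M.bayesThreshold

/-- The BFDR threshold `t⋆(α) = Ψ⁻¹(q τ) ∈ (0,1)`, with `q = α⁻¹ - 1`. -/
def bfdrThreshold (M : Model) (α : ℝ) : ℝ :=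
  Function.invFunOn M.psi (Ioo 0 1) ((α⁻¹ - 1) * M.τ)

/-- The rate `r`: `r^loc` or `r^sc`. -/
def rate (M : Model) : ℝ :=
  match M.kind with
  | .location =>
      (M.ζ * Real.log M.τ + |upperTailInv M.ζ M.bayesPower| ^ M.ζ) ^ (1 - 1 / M.ζ)
  | .scale => M.ζ * Real.log M.τ + (upperTailInv M.ζ (M.bayesPower / 2)) ^ M.ζ

/-- The factor `K`. -/
def factor (M : Model) : ℝ :=
  match M.kind with
  | .location => density M.ζ 0
  | .scale =>
      2 * upperTailInv M.ζ (M.bayesPower / 2) * density M.ζ (upperTailInv M.ζ (M.bayesPower / 2))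

/-- The terms `D₁ = -log (ν π₀ (1 - ε))` and `D₂ = log (ν⁻¹ C τ⁻¹ m)` (used for `a = 1, 2`). -/
def devTerm (M : Model) (m : ℕ) (ν ε : ℝ) (a : ℕ) : ℝ :=
  if a = 1 then -Real.log (ν * M.prob0 * (1 - ε))
  else Real.log (ν⁻¹ * M.bayesPower * M.τ⁻¹ * m)

end Model

/-- The empirical c.d.f. of a family of `p`-values. -/
def empCDF {m : ℕ} (p : Fin m → ℝ) (t : ℝ) : ℝ :=
  (m : ℝ)⁻¹ * ((Finset.univ.filter fun i => p i ≤ t).card : ℝ)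

/-- The Benjamini-Hochberg threshold: the largest `t ∈ [0,1]` with `Ĝ(t) ≥ t / α`. -/
def bhThreshold {m : ℕ} (α : ℝ) (p : Fin m → ℝ) : ℝ :=
  sSup {t : ℝ | t ∈ Icc 0 1 ∧ t / α ≤ empCDF p t}

/-- The FDR threshold: the maximum of the Benjamini-Hochberg and Bonferroni thresholds. -/
def fdrThreshold {m : ℕ} (α : ℝ) (p : Fin m → ℝ) : ℝ := max (bhThreshold α p) (α / m)

/-- `(X_i, H_i)`, `i = 0, …, m`, are i.i.d. with the law of the model; the first `m` pairs are the
sample and the last one is the new data point of the inductive risk. -/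
structure IsSample {Ω : Type*} [MeasurableSpace Ω] (P : Measure Ω) (M : Model) {m : ℕ}
    (X : Fin (m + 1) → Ω → ℝ) (H : Fin (m + 1) → Ω → Bool) : Prop where
  indep : iIndepFun (fun i ω => (X i ω, H i ω)) P
  law : ∀ i, HasLaw (fun ω => (X i ω, H i ω)) M.pairLaw P

/-- The two misclassification risks. -/
inductive RiskKind where
  | transductiveRisk : RiskKind
  | inductiveRisk : RiskKind

/-- Misclassification risk of a threshold `T`, a function of the `m` sample `p`-values, for the
procedure that gives label `1` to the `p`-values that are at most `T`. -/
def risk {Ω : Type*} [MeasurableSpace Ω] (P : Measure Ω) (M : Model) {m : ℕ}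
    (X : Fin (m + 1) → Ω → ℝ) (H : Fin (m + 1) → Ω → Bool) (R : RiskKind)
    (T : (Fin m → ℝ) → ℝ) : ℝ :=
  let p : Fin (m + 1) → Ω → ℝ := fun i ω => M.pValue (X i ω)
  let t : Ω → ℝ := fun ω => T fun i => p i.castSucc ω
  let err : Fin (m + 1) → ℝ := fun i =>
    P.real {ω | p i ω ≤ t ω ∧ H i ω = false} + P.real {ω | t ω < p i ω ∧ H i ω = true}
  match R with
  | .transductiveRisk => (m : ℝ)⁻¹ * ∑ i : Fin m, err i.castSucc
  | .inductiveRisk => err (Fin.last m)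

end SubbotinFDR

end

open SubbotinFDR

/-! Both risks are averages of one-observation error probabilities, so it suffices to bound each of
these. A fixed threshold `t` has risk `π₀ t + π₁ (1 - F t)`, hence excess `π₁ (τ (t - t^B) + C - F
t)` over Bayes. Everything rests on one estimate, `exists_threshold_of_shrink`: dividing `t^B` by `e
^ A` loses at most `K A / r` in power.

To see it, write `t^B` as the null tail at `x`. By Bernoulli's inequality that tail falls by `e ^
(-δ x^(ζ-1))` when `x` moves by `δ`, so `δ = A / x^(ζ-1)` is enough, while the alternative tail
loses at most `δ` (or `δ / σ`) times a maximal density. In logarithms, the Bayes equation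
"likelihood ratio at `x` equals `τ`" gives `x^(ζ-1) = r` (location) and `x^ζ ≥ r` (scale).

BFDR: if `t⋆ ≥ t^B`, the identity `F t⋆ = q τ t⋆` with `q > 1` gives the first term of the maximum.
Otherwise shrink `t^B` with `A = log (q / q^opt) - log ν`. The condition on `r` keeps power at least
`ν C`, so `Ψ` at the shrunk point is at least `q τ`; as `Ψ` decreases, that point is below `t⋆` and
bounds its power loss.

FDR: setting `p_i` to `0` gives a BH threshold independent of observation `i` that rejects `p_i` in
the same cases. False positives are thus bounded by the mean of this threshold, which the crossing
equation `t = α Ĝ(t)` controls recursively (`integral_bhThreshold_le`). For false negatives a shrunk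
Bayes threshold lies below the FDR threshold, either with high probability by Chernoff (`a = 1`) or
surely, by the Bonferroni floor `α / m` (`a = 2`). -/

namespace SubbotinFDR

open Filter Topology

/-! ### The Subbotin density and its upper tail. -/

section Density

variable {ζ : ℝ}

lemma continuous_subbotinKernel (hζ : 1 ≤ ζ) :
    Continuous fun x : ℝ => Real.exp (-(|x| ^ ζ / ζ)) := by
  have h : Continuous fun x : ℝ => |x| ^ ζ :=
    continuous_abs.rpow_const fun _ => Or.inr (by linarith)
  fun_prop

lemma integrable_subbotinKernel (hζ : 1 ≤ ζ) :
    Integrable fun x : ℝ => Real.exp (-(|x| ^ ζ / ζ)) := by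
  have h0 : (0 : ℝ) < ζ := by linarith
  have h1 : IntegrableOn (fun x : ℝ => Real.exp (-(|x| ^ ζ / ζ))) (Ioi 0) := by
    have := integrableOn_rpow_mul_exp_neg_mul_rpow (p := ζ) (s := 0) (b := 1 / ζ) (by norm_num)
      h0 (by positivity)
    refine this.congr_fun (fun x hx => ?_) measurableSet_Ioi
    simp only [Real.rpow_zero, one_mul, abs_of_pos (mem_Ioi.1 hx)]
    congr 1
    ring
  have h2 : IntegrableOn (fun x : ℝ => Real.exp (-(|x| ^ ζ / ζ))) (Iio 0) := by
    have := IntegrableOn.comp_neg_Iio (c := (0 : ℝ))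
      (f := fun x : ℝ => Real.exp (-(|x| ^ ζ / ζ))) (by rw [neg_zero]; exact h1)
    simpa only [abs_neg] using this
  have h3 : IntegrableOn (fun x : ℝ => Real.exp (-(|x| ^ ζ / ζ))) (Iic 0) :=
    (integrableOn_Iic_iff_integrableOn_Iio ..).2 h2
  rw [← integrableOn_univ, ← Iic_union_Ioi (a := (0 : ℝ))]
  exact h3.union h1

lemma normConst_pos (hζ : 1 ≤ ζ) : 0 < normConst ζ := by
  unfold normConst
  rw [integral_pos_iff_support_of_nonneg (fun x => (Real.exp_pos _).le)
    (integrable_subbotinKernel hζ)]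
  have : Function.support (fun x : ℝ => Real.exp (-(|x| ^ ζ / ζ))) = univ := by
    ext x
    simp
  rw [this]
  simp

lemma density_pos (hζ : 1 ≤ ζ) (x : ℝ) : 0 < density ζ x :=
  mul_pos (inv_pos.2 (normConst_pos hζ)) (Real.exp_pos _)

lemma continuous_density (hζ : 1 ≤ ζ) : Continuous (density ζ) :=
  continuous_const.mul (continuous_subbotinKernel hζ)

lemma integrable_density (hζ : 1 ≤ ζ) : Integrable (density ζ) :=
  (integrable_subbotinKernel hζ).const_mul _

lemma integral_density (hζ : 1 ≤ ζ) : ∫ x, density ζ x = 1 := by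
  unfold density
  rw [integral_const_mul]
  exact inv_mul_cancel₀ (normConst_pos hζ).ne'

lemma density_neg (x : ℝ) : density ζ (-x) = density ζ x := by simp [density]

lemma density_le_of_abs_le (hζ : 1 ≤ ζ) {x y : ℝ} (h : |x| ≤ |y|) :
    density ζ y ≤ density ζ x := by
  unfold density
  have := normConst_pos hζ
  gcongr

lemma upperTail_eq_sub (hζ : 1 ≤ ζ) (a u : ℝ) :
    upperTail ζ u = upperTail ζ a - ∫ x in a..u, density ζ x := by
  have := intervalIntegral.integral_Ioi_sub_Ioi' (f := density ζ) (μ := volume) (a := a) (b := u)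
    (integrable_density hζ).integrableOn (integrable_density hζ).integrableOn
  unfold upperTail
  linarith

lemma hasDerivAt_upperTail (hζ : 1 ≤ ζ) (u : ℝ) :
    HasDerivAt (upperTail ζ) (-density ζ u) u := by
  rw [funext (upperTail_eq_sub hζ 0)]
  exact (intervalIntegral.integral_hasDerivAt_right
    ((integrable_density hζ).intervalIntegrable)
    (continuous_density hζ).aestronglyMeasurable.stronglyMeasurableAtFilter
    (continuous_density hζ).continuousAt).const_sub _

lemma continuous_upperTail (hζ : 1 ≤ ζ) : Continuous (upperTail ζ) :=
  continuous_iff_continuousAt.2 fun u => (hasDerivAt_upperTail hζ u).continuousAt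

lemma strictAnti_upperTail (hζ : 1 ≤ ζ) : StrictAnti (upperTail ζ) :=
  strictAnti_of_deriv_neg fun x => by
    rw [(hasDerivAt_upperTail hζ x).deriv]
    exact neg_neg_of_pos (density_pos hζ x)

lemma setIntegral_Iic_neg_density (u : ℝ) :
    ∫ x in Iic (-u), density ζ x = upperTail ζ u := by
  unfold upperTail
  have := integral_comp_neg_Iic (-u) (density ζ)
  simpa [density_neg] using this

lemma upperTail_neg (hζ : 1 ≤ ζ) (u : ℝ) : upperTail ζ (-u) = 1 - upperTail ζ u := by
  have h := intervalIntegral.integral_Iic_add_Ioi (f := density ζ) (μ := volume) (b := -u)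
    (integrable_density hζ).integrableOn (integrable_density hζ).integrableOn
  rw [integral_density hζ, setIntegral_Iic_neg_density] at h
  unfold upperTail at *
  linarith

lemma upperTail_zero (hζ : 1 ≤ ζ) : upperTail ζ 0 = 1 / 2 := by
  have := upperTail_neg hζ 0
  rw [neg_zero] at this
  linarith

lemma tendsto_upperTail_atTop (hζ : 1 ≤ ζ) : Tendsto (upperTail ζ) atTop (𝓝 0) := by
  rw [funext (upperTail_eq_sub hζ 0)]
  have := intervalIntegral_tendsto_integral_Ioi (f := density ζ) (μ := volume) 0
    (integrable_density hζ).integrableOn tendsto_id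
  have h2 := this.const_sub (upperTail ζ 0)
  have h3 : upperTail ζ 0 - ∫ x in Ioi 0, density ζ x = 0 := sub_self _
  rw [h3] at h2
  exact h2

lemma upperTail_pos (hζ : 1 ≤ ζ) (u : ℝ) : 0 < upperTail ζ u := by
  refine lt_of_le_of_lt ?_ (strictAnti_upperTail hζ (show u < u + 1 by linarith))
  exact (strictAnti_upperTail hζ).antitone.le_of_tendsto (tendsto_upperTail_atTop hζ) _

lemma upperTail_lt_one (hζ : 1 ≤ ζ) (u : ℝ) : upperTail ζ u < 1 := by
  have := upperTail_neg hζ u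
  have := upperTail_pos hζ (-u)
  linarith

lemma tendsto_upperTail_atBot (hζ : 1 ≤ ζ) : Tendsto (upperTail ζ) atBot (𝓝 1) := by
  have h : upperTail ζ = fun u => 1 - upperTail ζ (-u) := by
    ext u
    rw [upperTail_neg hζ]
    ring
  rw [h]
  simpa using ((tendsto_upperTail_atTop hζ).comp tendsto_neg_atBot_atTop).const_sub 1

lemma exists_upperTail_eq (hζ : 1 ≤ ζ) {t : ℝ} (ht : t ∈ Ioo (0 : ℝ) 1) :
    ∃ u, upperTail ζ u = t := by
  obtain ⟨a, ha⟩ := ((tendsto_upperTail_atTop hζ).eventually (gt_mem_nhds ht.1)).exists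
  obtain ⟨b, hb⟩ := ((tendsto_upperTail_atBot hζ).eventually (lt_mem_nhds ht.2)).exists
  exact mem_range_of_exists_le_of_exists_ge (continuous_upperTail hζ) ⟨a, ha.le⟩ ⟨b, hb.le⟩

lemma upperTailInv_upperTail (hζ : 1 ≤ ζ) (u : ℝ) : upperTailInv ζ (upperTail ζ u) = u :=
  Function.leftInverse_invFun (strictAnti_upperTail hζ).injective u

lemma upperTail_sub_le (hζ : 1 ≤ ζ) {a δ c : ℝ} (hδ : 0 ≤ δ)
    (hc : ∀ x ∈ Icc a (a + δ), density ζ x ≤ c) :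
    upperTail ζ a - upperTail ζ (a + δ) ≤ c * δ := by
  rw [upperTail_eq_sub hζ a (a + δ)]
  have h : ∫ x in a..a + δ, density ζ x ≤ ∫ _ in a..a + δ, c :=
    intervalIntegral.integral_mono_on (by linarith)
      ((integrable_density hζ).intervalIntegrable) (by simp) hc
  rw [intervalIntegral.integral_const] at h
  simp only [add_sub_cancel_left, smul_eq_mul] at h
  linarith

/-- Bernoulli's inequality for `1 + δ / y`, multiplied by `y ^ ζ`. -/
lemma rpow_add_mul_le (hζ : 1 ≤ ζ) {y δ : ℝ} (hy : 0 < y) (hδ : 0 ≤ δ) :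
    y ^ ζ + ζ * (δ * y ^ (ζ - 1)) ≤ (y + δ) ^ ζ := by
  have h := one_add_mul_self_le_rpow_one_add (s := δ / y)
    (by have : 0 ≤ δ / y := by positivity
        linarith) hζ
  have h1 : (y + δ) ^ ζ = y ^ ζ * (1 + δ / y) ^ ζ := by
    rw [← Real.mul_rpow hy.le (by positivity)]
    congr 1
    field_simp
  rw [h1, Real.rpow_sub_one hy.ne']
  have h2 := mul_le_mul_of_nonneg_left h (Real.rpow_nonneg hy.le ζ)
  refine le_trans (le_of_eq ?_) h2
  field_simp

lemma setIntegral_Ioi_comp_add_right (f : ℝ → ℝ) (x c : ℝ) :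
    ∫ y in Ioi x, f (y + c) = ∫ y in Ioi (x + c), f y := by
  have h := (measurePreserving_add_right (volume : Measure ℝ) c).setIntegral_preimage_emb
    (measurableEmbedding_addRight c) f (Ioi (x + c))
  simpa using h

/-- The upper tail decays at least exponentially, with rate the score `x ^ (ζ - 1)`. -/
lemma upperTail_add_le (hζ : 1 ≤ ζ) {x δ : ℝ} (hx : 0 < x) (hδ : 0 ≤ δ) :
    upperTail ζ (x + δ) ≤ upperTail ζ x * Real.exp (-(δ * x ^ (ζ - 1))) := by
  have h1 : upperTail ζ (x + δ) = ∫ y in Ioi x, density ζ (y + δ) := by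
    unfold upperTail
    rw [setIntegral_Ioi_comp_add_right]
  rw [h1]
  unfold upperTail
  rw [← integral_mul_const]
  refine setIntegral_mono_on ((integrable_density hζ).comp_add_right δ).integrableOn
    ((integrable_density hζ).integrableOn.mul_const _) measurableSet_Ioi fun y hy => ?_
  have hxy : x < y := hy
  have hy0 : 0 < y := hx.trans hxy
  unfold density
  rw [mul_assoc, ← Real.exp_add]
  have := normConst_pos hζ
  gcongr
  rw [abs_of_pos hy0, abs_of_pos (by linarith : 0 < y + δ)]
  have h3 := rpow_add_mul_le hζ hy0 hδ
  have h4 : δ * x ^ (ζ - 1) ≤ δ * y ^ (ζ - 1) := by gcongr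
  have h5 : (y ^ ζ + ζ * (δ * y ^ (ζ - 1))) / ζ ≤ (y + δ) ^ ζ / ζ := by gcongr
  have h6 : (y ^ ζ + ζ * (δ * y ^ (ζ - 1))) / ζ = y ^ ζ / ζ + δ * y ^ (ζ - 1) := by
    field_simp
  linarith

end Density

/-- Null and alternative tails `T` and `G` of a test statistic with values in an open upper set
`I`, with densities `g` and `g₁` whose likelihood ratio is increasing and unbounded; `F` is the
c.d.f. of the `p`-value `T` under the alternative. -/
structure TailPair (I : Set ℝ) (T G g g₁ F : ℝ → ℝ) : Prop where
  isOpen : IsOpen I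
  isUpperSet : IsUpperSet I
  nonempty : I.Nonempty
  deriv_null : ∀ x ∈ I, HasDerivAt T (-g x) x
  deriv_alt : ∀ x ∈ I, HasDerivAt G (-g₁ x) x
  continuous_null : Continuous g
  continuous_alt : Continuous g₁
  pos : ∀ x, 0 < g x
  strictMono_ratio : StrictMonoOn (fun x => g₁ x / g x) I
  tendsto_ratio : Tendsto (fun x => g₁ x / g x) atTop atTop
  tendsto_null : Tendsto T atTop (𝓝 0)
  tendsto_alt : Tendsto G atTop (𝓝 0)
  mapsTo : ∀ x ∈ I, T x ∈ Ioo (0 : ℝ) 1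
  surjOn : ∀ t ∈ Ioo (0 : ℝ) 1, ∃ x ∈ I, T x = t
  cdf_eq : ∀ x ∈ I, F (T x) = G x
  alt_le_one : ∀ x ∈ I, G x ≤ 1

/-! ### Monotone likelihood ratios: existence and monotonicity for `f` and `Ψ`. -/

namespace TailPair

variable {I : Set ℝ} {T G g g₁ F : ℝ → ℝ}

lemma convex (h : TailPair I T G g g₁ F) : Convex ℝ I :=
  h.isUpperSet.ordConnected.convex

lemma eventually_mem (h : TailPair I T G g g₁ F) : ∀ᶠ x in atTop, x ∈ I := by
  obtain ⟨a, ha⟩ := h.nonempty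
  filter_upwards [eventually_ge_atTop a] with x hx using h.isUpperSet hx ha

lemma strictAntiOn (h : TailPair I T G g g₁ F) : StrictAntiOn T I := by
  refine strictAntiOn_of_deriv_neg h.convex
    (fun x hx => (h.deriv_null x hx).continuousAt.continuousWithinAt) fun x hx => ?_
  rw [h.isOpen.interior_eq] at hx
  rw [(h.deriv_null x hx).deriv]
  exact neg_neg_of_pos (h.pos x)

/-- With the ratio frozen at its value `c` at `x`, the function `G - c T` strictly decreases on `[x,
∞)` and tends to `0`, so it is positive at `x`. In terms of `p`-values this is `t f(t) < F(t)`. -/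
lemma ratio_mul_lt (h : TailPair I T G g g₁ F) {x : ℝ} (hx : x ∈ I) :
    g₁ x / g x * T x < G x := by
  have hd : ∀ y ∈ Ici x, HasDerivAt (fun y => G y - g₁ x / g x * T y)
      (-g₁ y - g₁ x / g x * -g y) y := fun y hy =>
    (h.deriv_alt y (h.isUpperSet hy hx)).sub ((h.deriv_null y (h.isUpperSet hy hx)).const_mul _)
  have hanti : StrictAntiOn (fun y => G y - g₁ x / g x * T y) (Ici x) := by
    refine strictAntiOn_of_deriv_neg (convex_Ici x)
      (fun y hy => (hd y hy).continuousAt.continuousWithinAt) fun y hy => ?_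
    rw [interior_Ici] at hy
    rw [(hd y (mem_Ici_of_Ioi hy)).deriv]
    have h1 := h.strictMono_ratio hx (h.isUpperSet (le_of_lt hy) hx) hy
    have h2 := mul_lt_mul_of_pos_right h1 (h.pos y)
    simp only at h2
    rw [div_mul_cancel₀ _ (h.pos y).ne'] at h2
    linarith
  have hlim : Tendsto (fun y => G y - g₁ x / g x * T y) atTop (𝓝 0) := by
    simpa using h.tendsto_alt.sub (h.tendsto_null.const_mul (g₁ x / g x))
  have h1 : 0 ≤ G (x + 1) - g₁ x / g x * T (x + 1) := by
    refine le_of_tendsto hlim ?_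
    filter_upwards [eventually_ge_atTop (x + 1)] with y hy
    exact hanti.antitoneOn (show x ≤ x + 1 by linarith) (show x ≤ y by linarith) hy
  have h2 := hanti self_mem_Ici (show x ≤ x + 1 by linarith) (show x < x + 1 by linarith)
  simp only at h2
  linarith

lemma strictMonoOn_tail_ratio (h : TailPair I T G g g₁ F) :
    StrictMonoOn (fun x => G x / T x) I := by
  have hd : ∀ x ∈ I, HasDerivAt (fun x => G x / T x)
      ((-g₁ x * T x - G x * -g x) / T x ^ 2) x := fun x hx =>
    (h.deriv_alt x hx).div (h.deriv_null x hx) (h.mapsTo x hx).1.ne'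
  refine strictMonoOn_of_deriv_pos h.convex
    (fun x hx => (hd x hx).continuousAt.continuousWithinAt) fun x hx => ?_
  rw [h.isOpen.interior_eq] at hx
  rw [(hd x hx).deriv]
  have hT := (h.mapsTo x hx).1
  have h1 := mul_lt_mul_of_pos_right (h.ratio_mul_lt hx) (h.pos x)
  have h2 : g₁ x / g x * T x * g x = g₁ x * T x := by
    have := (h.pos x).ne'
    field_simp
  refine div_pos ?_ (by positivity)
  linarith

lemma strictAntiOn_psi (h : TailPair I T G g g₁ F) :
    StrictAntiOn (fun t => F t / t) (Ioo 0 1) := by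
  intro s hs t ht hst
  obtain ⟨x, hx, rfl⟩ := h.surjOn s hs
  obtain ⟨y, hy, rfl⟩ := h.surjOn t ht
  have hyx : y < x := (h.strictAntiOn.lt_iff_gt hx hy).1 hst
  simpa [h.cdf_eq x hx, h.cdf_eq y hy] using h.strictMonoOn_tail_ratio hy hx hyx

/-- Near `T x`, `F` is `G` composed with the local inverse of `T`, so the chain rule identifies `f`
with the likelihood ratio. -/
lemma hasDerivAt_cdf (h : TailPair I T G g g₁ F) {x : ℝ} (hx : x ∈ I) :
    HasDerivAt F (g₁ x / g x) (T x) := by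
  have hs : HasStrictDerivAt T (-g x) x :=
    hasStrictDerivAt_of_hasDerivAt_of_continuousAt (f' := fun x => -g x)
      (Filter.mem_of_superset (h.isOpen.mem_nhds hx) fun y hy => h.deriv_null y hy)
      h.continuous_null.neg.continuousAt
  have hne : -g x ≠ 0 := neg_ne_zero.2 (h.pos x).ne'
  have hS := (hs.to_localInverse hne).hasDerivAt
  have hSx : hs.localInverse T (-g x) x hne (T x) = x :=
    (hs.eventually_left_inverse hne).self_of_nhds
  have hmem : ∀ᶠ t in 𝓝 (T x), hs.localInverse T (-g x) x hne t ∈ I := by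
    refine hS.continuousAt.eventually ?_
    rw [hSx]
    exact h.isOpen.mem_nhds hx
  have hG : HasDerivAt G (-g₁ x) (hs.localInverse T (-g x) x hne (T x)) := by
    rw [hSx]
    exact h.deriv_alt x hx
  have hc := hG.comp (T x) hS
  have hval : -g₁ x * (-g x)⁻¹ = g₁ x / g x := by
    rw [inv_neg, neg_mul_neg, div_eq_mul_inv]
  rw [hval] at hc
  refine hc.congr_of_eventuallyEq ?_
  filter_upwards [hmem, hs.eventually_right_inverse hne] with t ht1 ht2
  rw [Function.comp_apply, ← h.cdf_eq _ ht1, ht2]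

/-- At the point where `T` equals `1 / c`, the bound `G ≤ 1` suffices. This is the lower end for
both intermediate value arguments below. -/
lemma exists_tail_ratio_le (h : TailPair I T G g g₁ F) {c : ℝ} (hc : 1 < c) :
    ∃ x ∈ I, G x / T x ≤ c := by
  obtain ⟨x, hx, hT⟩ := h.surjOn c⁻¹ ⟨by positivity, inv_lt_one_of_one_lt₀ hc⟩
  refine ⟨x, hx, ?_⟩
  rw [hT, div_inv_eq_mul]
  have := h.alt_le_one x hx
  nlinarith

lemma exists_ratio_eq (h : TailPair I T G g g₁ F) {c : ℝ} (hc : 1 < c) :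
    ∃ x ∈ I, g₁ x / g x = c := by
  obtain ⟨a, ha, hac⟩ := h.exists_tail_ratio_le hc
  obtain ⟨b, hbI, hb⟩ := (h.eventually_mem.and (h.tendsto_ratio.eventually_ge_atTop c)).exists
  have hT := (h.mapsTo a ha).1
  have ha' : g₁ a / g a ≤ c := ((lt_div_iff₀ hT).2 (h.ratio_mul_lt ha)).le.trans hac
  exact h.convex.isPreconnected.intermediate_value ha hbI
    (h.continuous_alt.div h.continuous_null fun x => (h.pos x).ne').continuousOn ⟨ha', hb⟩

lemma exists_tail_ratio_eq (h : TailPair I T G g g₁ F) {c : ℝ} (hc : 1 < c) :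
    ∃ x ∈ I, G x / T x = c := by
  obtain ⟨a, ha, hac⟩ := h.exists_tail_ratio_le hc
  obtain ⟨b, hb, hbc⟩ := h.exists_ratio_eq hc
  have hT := (h.mapsTo b hb).1
  have hb' : c ≤ G b / T b := hbc ▸ ((lt_div_iff₀ hT).2 (h.ratio_mul_lt hb)).le
  refine h.convex.isPreconnected.intermediate_value ha hb (fun x hx => ?_) ⟨hac, hb'⟩
  exact ((h.deriv_alt x hx).div (h.deriv_null x hx)
    (h.mapsTo x hx).1.ne').continuousAt.continuousWithinAt

/-- The Bayes threshold is the null tail at the point where the likelihood ratio is `c`. -/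
lemma exists_invFunOn_deriv_eq (h : TailPair I T G g g₁ F) {c : ℝ} (hc : 1 < c) :
    ∃ x ∈ I, g₁ x / g x = c ∧ T x = Function.invFunOn (deriv F) (Ioo 0 1) c := by
  obtain ⟨x, hx, hxc⟩ := h.exists_ratio_eq hc
  have hex : ∃ t ∈ Ioo (0 : ℝ) 1, deriv F t = c :=
    ⟨T x, h.mapsTo x hx, (h.hasDerivAt_cdf hx).deriv.trans hxc⟩
  obtain ⟨y, hy, hyT⟩ := h.surjOn _ (Function.invFunOn_mem hex)
  refine ⟨y, hy, ?_, hyT⟩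
  rw [← (h.hasDerivAt_cdf hy).deriv, hyT, Function.invFunOn_eq hex]

lemma exists_psi_eq (h : TailPair I T G g g₁ F) {c : ℝ} (hc : 1 < c) :
    ∃ t ∈ Ioo (0 : ℝ) 1, F t / t = c := by
  obtain ⟨x, hx, hxc⟩ := h.exists_tail_ratio_eq hc
  exact ⟨T x, h.mapsTo x hx, by rw [h.cdf_eq x hx, hxc]⟩

end TailPair

/-! ### Laws of the `p`-values under the two labels. -/

section Laws

variable {ζ : ℝ}

lemma withDensity_real_eq_setIntegral {f : ℝ → ℝ} (hf : Integrable f) (h0 : ∀ x, 0 ≤ f x)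
    {s : Set ℝ} (hs : MeasurableSet s) :
    (volume.withDensity fun x => ENNReal.ofReal (f x)).real s = ∫ x in s, f x := by
  rw [measureReal_def, withDensity_apply _ hs,
    ← ofReal_integral_eq_lintegral_ofReal hf.integrableOn (ae_of_all _ h0),
    ENNReal.toReal_ofReal (integral_nonneg h0)]

lemma isProbabilityMeasure_withDensity_ofReal {f : ℝ → ℝ} (hf : Integrable f)
    (h0 : ∀ x, 0 ≤ f x) (h1 : ∫ x, f x = 1) :
    IsProbabilityMeasure (volume.withDensity fun x => ENNReal.ofReal (f x)) := by
  constructor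
  rw [withDensity_apply _ MeasurableSet.univ, Measure.restrict_univ,
    ← ofReal_integral_eq_lintegral_ofReal hf (ae_of_all _ h0), h1, ENNReal.ofReal_one]

lemma integrable_density_sub (hζ : 1 ≤ ζ) (μ : ℝ) : Integrable fun x => density ζ (x - μ) :=
  (integrable_density hζ).comp_sub_right μ

lemma integrable_density_div (hζ : 1 ≤ ζ) {σ : ℝ} (hσ : 0 < σ) :
    Integrable fun x => density ζ (x / σ) / σ :=
  ((integrable_density hζ).comp_div hσ.ne').div_const σ

lemma location_law_tail (hζ : 1 ≤ ζ) (μ x : ℝ) :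
    (volume.withDensity fun y => ENNReal.ofReal (density ζ (y - μ))).real
      {y | upperTail ζ y ≤ upperTail ζ x} = upperTail ζ (x - μ) := by
  have hset : {y | upperTail ζ y ≤ upperTail ζ x} = Ici x := by
    ext y
    exact (strictAnti_upperTail hζ).le_iff_ge
  rw [hset, withDensity_real_eq_setIntegral (integrable_density_sub hζ μ)
    (fun y => (density_pos hζ _).le) measurableSet_Ici, integral_Ici_eq_integral_Ioi]
  exact setIntegral_Ioi_comp_add_right (density ζ) x (-μ)

lemma scale_law_tail (hζ : 1 ≤ ζ) {σ x : ℝ} (hσ : 0 < σ) (hx : 0 < x) :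
    (volume.withDensity fun y => ENNReal.ofReal (density ζ (y / σ) / σ)).real
      {y | 2 * upperTail ζ |y| ≤ 2 * upperTail ζ x} = 2 * upperTail ζ (x / σ) := by
  have hset : {y | 2 * upperTail ζ |y| ≤ 2 * upperTail ζ x} = Iic (-x) ∪ Ici x := by
    ext y
    have : 2 * upperTail ζ |y| ≤ 2 * upperTail ζ x ↔ x ≤ |y| := by
      rw [mul_le_mul_iff_right₀ two_pos]
      exact (strictAnti_upperTail hζ).le_iff_ge
    rw [mem_ofPred_eq, this, le_abs', mem_union, mem_Iic, mem_Ici]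
  have hint := integrable_density_div hζ hσ
  have hdisj : Disjoint (Iic (-x)) (Ici x) :=
    Set.disjoint_left.2 fun y hy hy' => by
      have h1 : y ≤ -x := hy
      have h2 : x ≤ y := hy'
      linarith
  have h1 : ∫ y in Ioi x, density ζ (y / σ) / σ = upperTail ζ (x / σ) := by
    have := integral_comp_mul_left_Ioi (density ζ) x (inv_pos.2 hσ)
    rw [integral_div]
    simp only [inv_mul_eq_div, inv_inv, smul_eq_mul] at this
    rw [this, mul_div_cancel_left₀ _ hσ.ne']
    rfl
  have h2 : ∫ y in Iic (-x), density ζ (y / σ) / σ = upperTail ζ (x / σ) := by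
    have := integral_comp_neg_Iic (-x) fun y => density ζ (y / σ) / σ
    simp only [neg_div, density_neg, neg_neg] at this
    rw [this, h1]
  rw [hset, withDensity_real_eq_setIntegral hint
    (fun y => (div_pos (density_pos hζ _) hσ).le) (measurableSet_Iic.union measurableSet_Ici),
    setIntegral_union hdisj measurableSet_Ici hint.integrableOn hint.integrableOn,
    integral_Ici_eq_integral_Ioi, h1, h2]
  ring

end Laws

namespace Model

lemma Admissible.one_le_shape {M : Model} (hM : M.Admissible) : 1 ≤ M.ζ := by
  obtain ⟨k, ζ, τ, θ⟩ := M
  cases k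
  · exact hM.2.1.le
  · exact hM.2.1

lemma isProbabilityMeasure_nullLaw {M : Model} (hM : M.Admissible) :
    IsProbabilityMeasure M.nullLaw :=
  isProbabilityMeasure_withDensity_ofReal (integrable_density hM.one_le_shape)
    (fun x => (density_pos hM.one_le_shape x).le) (integral_density hM.one_le_shape)

lemma isProbabilityMeasure_altLaw {M : Model} (hM : M.Admissible) :
    IsProbabilityMeasure M.altLaw := by
  have hζ := hM.one_le_shape
  obtain ⟨k, ζ, τ, θ⟩ := M
  cases k
  · refine isProbabilityMeasure_withDensity_ofReal (integrable_density_sub hζ θ)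
      (fun x => (density_pos hζ _).le) ?_
    exact (integral_sub_right_eq_self (density ζ) θ).trans (integral_density hζ)
  · have hθ : 0 < θ := one_pos.trans hM.2.2
    refine isProbabilityMeasure_withDensity_ofReal (integrable_density_div hζ hθ)
      (fun x => (div_pos (density_pos hζ _) hθ).le) ?_
    change ∫ x, density ζ (x / θ) / θ = 1
    rw [integral_div, Measure.integral_comp_div (density ζ) θ, integral_density hζ, abs_of_pos hθ]
    simp [hθ.ne']

lemma measurable_pValue {M : Model} (hM : M.Admissible) : Measurable M.pValue := by
  have hζ := hM.one_le_shape
  obtain ⟨k, ζ, τ, θ⟩ := M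
  cases k
  · exact (continuous_upperTail hζ).measurable
  · exact (continuous_const.mul ((continuous_upperTail hζ).comp continuous_abs)).measurable

lemma pValue_pos {M : Model} (hM : M.Admissible) (x : ℝ) : 0 < M.pValue x := by
  have hζ := hM.one_le_shape
  obtain ⟨k, ζ, τ, θ⟩ := M
  cases k
  · exact upperTail_pos hζ x
  · exact mul_pos two_pos (upperTail_pos hζ _)

/-- The null law is the alternative law with shift `0` or dilation `1`, so the tail formulas above
apply to it. -/
lemma nullLaw_pValue_le {M : Model} (hM : M.Admissible) {t : ℝ} (ht : t ∈ Ioo (0 : ℝ) 1) :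
    M.nullLaw.real {x | M.pValue x ≤ t} = t := by
  have hζ := hM.one_le_shape
  obtain ⟨k, ζ, τ, θ⟩ := M
  cases k
  · obtain ⟨x, rfl⟩ := exists_upperTail_eq hζ ht
    have h := location_law_tail hζ 0 x
    simp only [sub_zero] at h
    exact h
  · obtain ⟨x, hx⟩ := exists_upperTail_eq hζ (t := t / 2)
      ⟨by linarith [ht.1], by linarith [ht.2]⟩
    have hx0 : 0 < x := by
      rw [← (strictAnti_upperTail hζ).lt_iff_gt, hx, upperTail_zero hζ]
      linarith [ht.2]
    obtain rfl : t = 2 * upperTail ζ x := by linarith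
    have h := scale_law_tail hζ one_pos hx0
    simp only [div_one] at h
    exact h

lemma nullLaw_pValue_le_le {M : Model} (hM : M.Admissible) {t : ℝ} (ht : 0 ≤ t) :
    M.nullLaw.real {x | M.pValue x ≤ t} ≤ t := by
  have := isProbabilityMeasure_nullLaw hM
  rcases ht.eq_or_lt with rfl | ht
  · have : {x | M.pValue x ≤ 0} = ∅ := by
      ext x
      simpa using pValue_pos hM x
    simp [this]
  · rcases lt_or_ge t 1 with h1 | h1
    · exact (nullLaw_pValue_le hM ⟨ht, h1⟩).le
    · exact measureReal_le_one.trans h1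

lemma monotone_altCDF {M : Model} (hM : M.Admissible) : Monotone M.altCDF := by
  have := isProbabilityMeasure_altLaw hM
  exact fun s t hst => measureReal_mono fun x (hx : M.pValue x ≤ s) => le_trans hx hst

end Model

/-! ### The location and scale models have monotone likelihood ratio. -/

section TailPairs

variable {ζ : ℝ}

lemma density_div_density (hζ : 1 ≤ ζ) (x y : ℝ) :
    density ζ y / density ζ x = Real.exp (|x| ^ ζ / ζ - |y| ^ ζ / ζ) := by
  have h := (inv_pos.2 (normConst_pos hζ)).ne'
  unfold density
  rw [mul_div_mul_left _ _ h, ← Real.exp_sub]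
  congr 1
  ring

/-- Strict convexity of the power on `[0, ∞)` is enough unless `|x| = |y|`; then `y = -x`, and the
triangle inequality is the strict step. -/
lemma strictConvexOn_abs_rpow (hζ : 1 < ζ) : StrictConvexOn ℝ univ fun x : ℝ => |x| ^ ζ := by
  refine ⟨convex_univ, fun x _ y _ hxy a b ha hb hab => ?_⟩
  simp only [smul_eq_mul]
  have habs : |a * x + b * y| ≤ a * |x| + b * |y| := by
    refine (abs_add_le _ _).trans_eq ?_
    rw [abs_mul, abs_mul, abs_of_pos ha, abs_of_pos hb]
  by_cases h : |x| = |y|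
  · have hy : y = -x := by
      rcases abs_eq_abs.1 h with h | h
      · exact absurd h hxy
      · rw [h, neg_neg]
    subst hy
    have hx : 0 < |x| := abs_pos.2 fun h0 => hxy (by simp [h0])
    have hlt : |a * x + b * -x| < |x| := by
      have h1 : a * x + b * -x = (a - b) * x := by ring
      rw [h1, abs_mul]
      have h2 : |a - b| < 1 := abs_lt.2 ⟨by linarith, by linarith⟩
      nlinarith
    rw [abs_neg, ← add_mul, hab, one_mul]
    exact Real.rpow_lt_rpow (abs_nonneg _) hlt (by linarith)
  · refine (Real.rpow_le_rpow (abs_nonneg _) habs (by linarith)).trans_lt ?_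
    exact (strictConvexOn_rpow hζ).2 (abs_nonneg x) (abs_nonneg y) h ha hb hab

/-- Both `x` and `y - μ` are convex combinations of `x - μ` and `y`, with weights exchanged; adding
the two strict convexity inequalities gives the claim. For `ζ = 1` the difference is constant beyond
`μ`, whence `ζ > 1` in the location model. -/
lemma strictMono_abs_rpow_sub (hζ : 1 < ζ) {μ : ℝ} (hμ : 0 < μ) :
    StrictMono fun x : ℝ => |x| ^ ζ - |x - μ| ^ ζ := by
  intro x y hxy
  have hpos : 0 < y - x + μ := by linarith
  have hne : x - μ ≠ y := by linarith
  have h := strictConvexOn_abs_rpow hζ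
  have hab : (y - x) / (y - x + μ) + μ / (y - x + μ) = 1 := by
    rw [← add_div, div_self hpos.ne']
  have h1 := h.2 (mem_univ (x - μ)) (mem_univ y) hne (div_pos (sub_pos.2 hxy) hpos)
    (div_pos hμ hpos) hab
  have h2 := h.2 (mem_univ (x - μ)) (mem_univ y) hne (div_pos hμ hpos)
    (div_pos (sub_pos.2 hxy) hpos) ((add_comm _ _).trans hab)
  simp only [smul_eq_mul] at h1 h2
  have e1 : (y - x) / (y - x + μ) * (x - μ) + μ / (y - x + μ) * y = x := by
    field_simp
    ring
  have e2 : μ / (y - x + μ) * (x - μ) + (y - x) / (y - x + μ) * y = y - μ := by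
    field_simp
    ring
  rw [e1] at h1
  rw [e2] at h2
  have e3 : ∀ p q : ℝ, (y - x) / (y - x + μ) * p + μ / (y - x + μ) * q +
      (μ / (y - x + μ) * p + (y - x) / (y - x + μ) * q) = p + q := fun p q => by
    linear_combination (p + q) * hab
  have := e3 (|x - μ| ^ ζ) (|y| ^ ζ)
  change |x| ^ ζ - |x - μ| ^ ζ < |y| ^ ζ - |y - μ| ^ ζ
  linarith

lemma tendsto_abs_rpow_sub (hζ : 1 < ζ) {μ : ℝ} (hμ : 0 < μ) :
    Tendsto (fun x : ℝ => |x| ^ ζ / ζ - |x - μ| ^ ζ / ζ) atTop atTop := by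
  have h1 : Tendsto (fun x : ℝ => μ * (x - μ) ^ (ζ - 1)) atTop atTop :=
    ((tendsto_rpow_atTop (sub_pos.2 hζ)).comp
      (tendsto_atTop_add_const_right _ (-μ) tendsto_id)).const_mul_atTop hμ
  refine tendsto_atTop_mono' _ ?_ h1
  filter_upwards [eventually_gt_atTop μ] with x hx
  have h2 := rpow_add_mul_le hζ.le (sub_pos.2 hx) hμ.le
  rw [sub_add_cancel] at h2
  rw [abs_of_pos (hμ.trans hx), abs_of_pos (sub_pos.2 hx), ← sub_div, le_div_iff₀ (by linarith)]
  linarith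

lemma tailPair_location {τ θ : ℝ} (hM : Model.Admissible ⟨.location, ζ, τ, θ⟩) :
    TailPair univ (upperTail ζ) (fun x => upperTail ζ (x - θ)) (density ζ)
      (fun x => density ζ (x - θ)) (Model.altCDF ⟨.location, ζ, τ, θ⟩) := by
  have hζ := hM.one_le_shape
  have hζ' : 1 < ζ := hM.2.1
  have hθ : 0 < θ := hM.2.2
  refine
    { isOpen := isOpen_univ
      isUpperSet := isUpperSet_univ
      nonempty := univ_nonempty
      deriv_null := fun x _ => hasDerivAt_upperTail hζ x
      deriv_alt := fun x _ => (hasDerivAt_upperTail hζ (x - θ)).comp_sub_const x θ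
      continuous_null := continuous_density hζ
      continuous_alt := (continuous_density hζ).comp (continuous_sub_right θ)
      pos := density_pos hζ
      strictMono_ratio := fun x _ y _ hxy => ?_
      tendsto_ratio := ?_
      tendsto_null := tendsto_upperTail_atTop hζ
      tendsto_alt := (tendsto_upperTail_atTop hζ).comp
        (tendsto_atTop_add_const_right _ (-θ) tendsto_id)
      mapsTo := fun x _ => ⟨upperTail_pos hζ x, upperTail_lt_one hζ x⟩
      surjOn := fun t ht => (exists_upperTail_eq hζ ht).imp fun x hx => ⟨mem_univ x, hx⟩
      cdf_eq := fun x _ => location_law_tail hζ θ x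
      alt_le_one := fun x _ => (upperTail_lt_one hζ _).le }
  · simp only [density_div_density hζ, ← sub_div]
    have := strictMono_abs_rpow_sub hζ' hθ hxy
    gcongr
  · simp only [density_div_density hζ]
    exact Real.tendsto_exp_atTop.comp (tendsto_abs_rpow_sub hζ' hθ)

lemma scale_ratio (hζ : 1 ≤ ζ) {σ x : ℝ} (hσ : 0 < σ) (hx : 0 ≤ x) :
    2 * (density ζ (x / σ) / σ) / (2 * density ζ x) =
      σ⁻¹ * Real.exp ((1 - (σ ^ ζ)⁻¹) / ζ * x ^ ζ) := by
  have h : 2 * (density ζ (x / σ) / σ) / (2 * density ζ x) =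
      σ⁻¹ * (density ζ (x / σ) / density ζ x) := by
    have := (density_pos hζ x).ne'
    field_simp
  rw [h, density_div_density hζ, abs_of_nonneg hx, abs_of_nonneg (by positivity : 0 ≤ x / σ),
    Real.div_rpow hx hσ.le]
  congr 2
  ring

/-- The test statistic is `|X|`, so the tails live on the half-line and the densities are doubled.
-/
lemma tailPair_scale {τ θ : ℝ} (hM : Model.Admissible ⟨.scale, ζ, τ, θ⟩) :
    TailPair (Ioi 0) (fun x => 2 * upperTail ζ x) (fun x => 2 * upperTail ζ (x / θ))
      (fun x => 2 * density ζ x) (fun x => 2 * (density ζ (x / θ) / θ))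
      (Model.altCDF ⟨.scale, ζ, τ, θ⟩) := by
  have hζ := hM.one_le_shape
  change 1 ≤ ζ at hζ
  have hζ0 : 0 < ζ := by linarith
  have hθ1 : 1 < θ := hM.2.2
  have hθ : 0 < θ := one_pos.trans hθ1
  have hc : 0 < (1 - (θ ^ ζ)⁻¹) / ζ :=
    div_pos (sub_pos.2 (inv_lt_one_of_one_lt₀ (Real.one_lt_rpow hθ1 hζ0))) hζ0
  have hhalf : ∀ x : ℝ, 0 < x → 2 * upperTail ζ x < 1 := fun x hx => by
    have := strictAnti_upperTail hζ hx
    rw [upperTail_zero hζ] at this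
    linarith
  refine
    { isOpen := isOpen_Ioi
      isUpperSet := isUpperSet_Ioi 0
      nonempty := nonempty_Ioi
      deriv_null := fun x _ => ?_
      deriv_alt := fun x _ => ?_
      continuous_null := continuous_const.mul (continuous_density hζ)
      continuous_alt := continuous_const.mul
        (((continuous_density hζ).comp (continuous_id.div_const θ)).div_const θ)
      pos := fun x => mul_pos two_pos (density_pos hζ x)
      strictMono_ratio := fun x hx y hy hxy => ?_
      tendsto_ratio := ?_
      tendsto_null := by simpa using (tendsto_upperTail_atTop hζ).const_mul 2
      tendsto_alt := by
        simpa using ((tendsto_upperTail_atTop hζ).comp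
          (tendsto_id.atTop_div_const hθ)).const_mul 2
      mapsTo := fun x hx => ⟨mul_pos two_pos (upperTail_pos hζ x), hhalf x hx⟩
      surjOn := fun t ht => ?_
      cdf_eq := fun x hx => scale_law_tail hζ hθ hx
      alt_le_one := fun x hx => (hhalf _ (div_pos hx hθ)).le }
  · simpa using (hasDerivAt_upperTail hζ x).const_mul 2
  · have := ((hasDerivAt_upperTail hζ (x / θ)).comp x ((hasDerivAt_id x).div_const θ)).const_mul 2
    refine this.congr_deriv ?_
    ring
  · have hx0 : (0 : ℝ) < x := hx
    have hy0 : (0 : ℝ) < y := hy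
    simp only [scale_ratio hζ hθ hx0.le, scale_ratio hζ hθ hy0.le]
    have := Real.rpow_lt_rpow hx0.le hxy hζ0
    gcongr
  · have h1 : Tendsto (fun x : ℝ => θ⁻¹ * Real.exp ((1 - (θ ^ ζ)⁻¹) / ζ * x ^ ζ)) atTop atTop :=
      (Real.tendsto_exp_atTop.comp
        ((tendsto_rpow_atTop hζ0).const_mul_atTop hc)).const_mul_atTop (inv_pos.2 hθ)
    refine h1.congr' ?_
    filter_upwards [eventually_ge_atTop 0] with x hx using (scale_ratio hζ hθ hx).symm
  · obtain ⟨x, hx⟩ := exists_upperTail_eq hζ (t := t / 2)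
      ⟨by linarith [ht.1], by linarith [ht.2]⟩
    refine ⟨x, ?_, by linarith⟩
    rw [mem_Ioi, ← (strictAnti_upperTail hζ).lt_iff_gt, hx, upperTail_zero hζ]
    linarith [ht.2]

end TailPairs

/-! ### Bayes and BFDR thresholds, and the power cost of shrinking. -/

namespace Model

variable {M : Model}

lemma exists_tailPair (hM : M.Admissible) :
    ∃ I T G g g₁, TailPair I T G g g₁ M.altCDF := by
  obtain ⟨k, ζ, τ, θ⟩ := M
  cases k
  · exact ⟨_, _, _, _, _, tailPair_location hM⟩
  · exact ⟨_, _, _, _, _, tailPair_scale hM⟩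

lemma strictAntiOn_psi (hM : M.Admissible) : StrictAntiOn M.psi (Ioo 0 1) := by
  obtain ⟨I, T, G, g, g₁, h⟩ := exists_tailPair hM
  exact h.strictAntiOn_psi

lemma bayesThreshold_mem (hM : M.Admissible) : M.bayesThreshold ∈ Ioo (0 : ℝ) 1 := by
  obtain ⟨I, T, G, g, g₁, h⟩ := exists_tailPair hM
  obtain ⟨x, hx, -, hxt⟩ := h.exists_invFunOn_deriv_eq hM.1
  unfold bayesThreshold
  rw [← hxt]
  exact h.mapsTo x hx

lemma mul_bayesThreshold_lt_bayesPower (hM : M.Admissible) :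
    M.τ * M.bayesThreshold < M.bayesPower := by
  obtain ⟨I, T, G, g, g₁, h⟩ := exists_tailPair hM
  obtain ⟨x, hx, hxc, hxt⟩ := h.exists_invFunOn_deriv_eq hM.1
  unfold bayesPower bayesThreshold
  rw [← hxt, h.cdf_eq x hx, ← hxc]
  exact h.ratio_mul_lt hx

lemma bayesPower_pos (hM : M.Admissible) : 0 < M.bayesPower :=
  (mul_pos (one_pos.trans hM.1) (bayesThreshold_mem hM).1).trans
    (mul_bayesThreshold_lt_bayesPower hM)

lemma bfdrThreshold_spec (hM : M.Admissible) {α : ℝ} (hα : α ∈ Ioo (0 : ℝ) (1 / 2)) :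
    M.bfdrThreshold α ∈ Ioo (0 : ℝ) 1 ∧
      M.psi (M.bfdrThreshold α) = (α⁻¹ - 1) * M.τ := by
  obtain ⟨I, T, G, g, g₁, h⟩ := exists_tailPair hM
  -- `α < 1/2` means `q > 1`, hence `q τ > 1`: levels above `1` are the ones that `Ψ` is known to
  -- attain.
  have h2 : 2 < α⁻¹ := (lt_inv_comm₀ two_pos hα.1).2 (by linarith [hα.2])
  have hc : 1 < (α⁻¹ - 1) * M.τ := by nlinarith [hM.1]
  have hex : ∃ t ∈ Ioo (0 : ℝ) 1, M.psi t = (α⁻¹ - 1) * M.τ := h.exists_psi_eq hc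
  exact ⟨Function.invFunOn_mem hex, Function.invFunOn_eq hex⟩

/-- Shrinking the Bayes threshold by a factor `e ^ (-A)` costs at most `K A / r` in power. -/
lemma exists_threshold_of_shrink (hM : M.Admissible) :
    0 < M.rate ∧ 0 ≤ M.factor ∧ ∀ A : ℝ, 0 ≤ A → ∃ t ∈ Ioo (0 : ℝ) 1,
      t ≤ M.bayesThreshold * Real.exp (-A) ∧
      M.bayesPower - M.factor * (A / M.rate) ≤ M.altCDF t := by
  have hζ := hM.one_le_shape
  obtain ⟨k, ζ, τ, θ⟩ := M
  change 1 ≤ ζ at hζ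
  have hζ0 : 0 < ζ := by linarith
  have hlog : 0 < Real.log τ := Real.log_pos hM.1
  have hτ : 0 < τ := one_pos.trans hM.1
  cases k
  · have h := tailPair_location hM
    obtain ⟨x, -, hxc, hxt⟩ := h.exists_invFunOn_deriv_eq hM.1
    change density ζ (x - θ) / density ζ x = τ at hxc
    have hθ : 0 < θ := hM.2.2
    have hB : Model.bayesThreshold ⟨.location, ζ, τ, θ⟩ = upperTail ζ x := hxt.symm
    have hC : Model.bayesPower ⟨.location, ζ, τ, θ⟩ = upperTail ζ (x - θ) := by
      unfold bayesPower
      rw [hB]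
      exact h.cdf_eq x (mem_univ x)
    rw [density_div_density hζ, ← Real.exp_log hτ, Real.exp_eq_exp, ← sub_div,
      div_eq_iff hζ0.ne'] at hxc
    -- `τ > 1` puts `x` strictly nearer to the shift `θ > 0` than to `0`, so `x` is positive and the
    -- exponential tail decay applies.
    have hx : 0 < x := by
      have h1 : |x - θ| < |x| := by
        rw [← Real.rpow_lt_rpow_iff (abs_nonneg _) (abs_nonneg _) hζ0]
        nlinarith
      have h2 := sq_lt_sq.2 h1
      nlinarith
    rw [abs_of_pos hx] at hxc
    have hrate : Model.rate ⟨.location, ζ, τ, θ⟩ = x ^ (ζ - 1) := by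
      change (ζ * Real.log τ +
        |upperTailInv ζ (Model.bayesPower ⟨.location, ζ, τ, θ⟩)| ^ ζ) ^ (1 - 1 / ζ) = _
      have e : ζ * Real.log τ + |x - θ| ^ ζ = x ^ ζ := by linarith
      rw [hC, upperTailInv_upperTail hζ, e, ← Real.rpow_mul hx.le]
      congr 1
      field_simp
    have hr : 0 < x ^ (ζ - 1) := Real.rpow_pos_of_pos hx _
    rw [hrate, hB, hC]
    refine ⟨hr, (density_pos hζ 0).le, fun A hA => ?_⟩
    -- This displacement makes the decay factor of the null tail exactly `e ^ (-A)`.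
    have hδ : 0 ≤ A / x ^ (ζ - 1) := by positivity
    refine ⟨upperTail ζ (x + A / x ^ (ζ - 1)), h.mapsTo _ (mem_univ _), ?_, ?_⟩
    · have := upperTail_add_le hζ hx hδ
      rwa [div_mul_cancel₀ _ hr.ne'] at this
    · have h1 := upperTail_sub_le hζ (a := x - θ) hδ (c := density ζ 0)
        fun y _ => density_le_of_abs_le hζ (by simp)
      rw [h.cdf_eq _ (mem_univ _)]
      have e : x - θ + A / x ^ (ζ - 1) = x + A / x ^ (ζ - 1) - θ := by ring
      rw [e] at h1
      change _ - density ζ 0 * _ ≤ _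
      linarith
  · have h := tailPair_scale hM
    obtain ⟨x, hx, hxc, hxt⟩ := h.exists_invFunOn_deriv_eq hM.1
    change 2 * (density ζ (x / θ) / θ) / (2 * density ζ x) = τ at hxc
    replace hx : 0 < x := hx
    have hθ1 : 1 < θ := hM.2.2
    have hθ : 0 < θ := one_pos.trans hθ1
    have hB : Model.bayesThreshold ⟨.scale, ζ, τ, θ⟩ = 2 * upperTail ζ x := hxt.symm
    have hC : Model.bayesPower ⟨.scale, ζ, τ, θ⟩ = 2 * upperTail ζ (x / θ) := by
      unfold bayesPower
      rw [hB]
      exact h.cdf_eq x hx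
    have hinv : upperTailInv ζ (Model.bayesPower ⟨.scale, ζ, τ, θ⟩ / 2) = x / θ := by
      rw [hC, mul_div_cancel_left₀ _ two_ne_zero, upperTailInv_upperTail hζ]
    have hxθ : 0 < x / θ := by positivity
    have hrate : Model.rate ⟨.scale, ζ, τ, θ⟩ = ζ * Real.log τ + (x / θ) ^ ζ := by
      change ζ * Real.log τ +
        (upperTailInv ζ (Model.bayesPower ⟨.scale, ζ, τ, θ⟩ / 2)) ^ ζ = _
      rw [hinv]
    have hfac : Model.factor ⟨.scale, ζ, τ, θ⟩ = 2 * (x / θ) * density ζ (x / θ) := by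
      change 2 * upperTailInv ζ (Model.bayesPower ⟨.scale, ζ, τ, θ⟩ / 2) *
        density ζ (upperTailInv ζ (Model.bayesPower ⟨.scale, ζ, τ, θ⟩ / 2)) = _
      rw [hinv]
    have hd := density_pos hζ (x / θ)
    have hr : 0 < ζ * Real.log τ + (x / θ) ^ ζ := by positivity
    -- The log Bayes equation is `x^ζ = ζ log τ + ζ log θ + (x/θ)^ζ`; the positive middle term is
    -- dropped.
    have hrx : ζ * Real.log τ + (x / θ) ^ ζ ≤ x ^ ζ := by
      rw [scale_ratio hζ hθ hx.le] at hxc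
      rw [← hxc, Real.log_mul (inv_pos.2 hθ).ne' (Real.exp_pos _).ne', Real.log_inv,
        Real.log_exp, Real.div_rpow hx.le hθ.le]
      have h1 : ζ * ((1 - (θ ^ ζ)⁻¹) / ζ * x ^ ζ) = x ^ ζ - x ^ ζ / θ ^ ζ := by
        field_simp
      have h2 := Real.log_pos hθ1
      have h3 : 0 < ζ * Real.log θ := by positivity
      linarith
    rw [hrate, hB, hC, hfac]
    refine ⟨hr, by positivity, fun A hA => ?_⟩
    have hs : 0 < x ^ (ζ - 1) := Real.rpow_pos_of_pos hx _
    have hδ : 0 ≤ A / x ^ (ζ - 1) := by positivity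
    have hmem : x + A / x ^ (ζ - 1) ∈ Ioi (0 : ℝ) := by
      rw [mem_Ioi]
      positivity
    refine ⟨2 * upperTail ζ (x + A / x ^ (ζ - 1)), h.mapsTo _ hmem, ?_, ?_⟩
    · have := upperTail_add_le hζ hx hδ
      rw [div_mul_cancel₀ _ hs.ne'] at this
      linarith
    · have hδ' : 0 ≤ A / x ^ (ζ - 1) / θ := by positivity
      -- The interval is to the right of `0`, so the density is largest at its left end, unlike the
      -- location case, where only the mode is a safe bound.
      have h1 := upperTail_sub_le hζ (a := x / θ) hδ' (c := density ζ (x / θ))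
        fun y hy => density_le_of_abs_le hζ (by
          rw [abs_of_pos hxθ, abs_of_pos (hxθ.trans_le hy.1)]
          exact hy.1)
      have h0 := h.cdf_eq _ hmem
      rw [h0, add_div]
      have h2 : 2 * (x / θ) * density ζ (x / θ) * (A / x ^ ζ) ≤
          2 * (x / θ) * density ζ (x / θ) * (A / (ζ * Real.log τ + (x / θ) ^ ζ)) := by
        gcongr
      have h3 : 2 * (density ζ (x / θ) * (A / x ^ (ζ - 1) / θ)) =
          2 * (x / θ) * density ζ (x / θ) * (A / x ^ ζ) := by
        rw [Real.rpow_sub_one hx.ne']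
        have := Real.rpow_pos_of_pos hx ζ
        field_simp
      linarith

end Model

/-! ### The BH threshold: crossing equation, leave-one-out, measurability. -/

section BenjaminiHochberg

variable {m : ℕ} {α : ℝ}

lemma empCDF_nonneg (p : Fin m → ℝ) (t : ℝ) : 0 ≤ empCDF p t := by
  unfold empCDF
  positivity

lemma empCDF_le_one (p : Fin m → ℝ) (t : ℝ) : empCDF p t ≤ 1 := by
  unfold empCDF
  have h : ((Finset.univ.filter fun i => p i ≤ t).card : ℝ) ≤ m := by
    exact_mod_cast (Finset.card_filter_le _ _).trans_eq (by simp)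
  rw [inv_mul_eq_div]
  exact div_le_one_of_le₀ h (by positivity)

lemma empCDF_le_empCDF {p p' : Fin m → ℝ} {t t' : ℝ} (h : ∀ i, p i ≤ t → p' i ≤ t') :
    empCDF p t ≤ empCDF p' t' := by
  unfold empCDF
  have : (Finset.univ.filter fun i => p i ≤ t) ⊆ Finset.univ.filter fun i => p' i ≤ t' :=
    Finset.monotone_filter_right _ fun i _ hi => h i hi
  gcongr

lemma empCDF_mono (p : Fin m → ℝ) {s t : ℝ} (h : s ≤ t) : empCDF p s ≤ empCDF p t :=
  empCDF_le_empCDF fun _ hi => hi.trans h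

lemma bddAbove_bhSet (p : Fin m → ℝ) :
    BddAbove {t : ℝ | t ∈ Icc (0 : ℝ) 1 ∧ t / α ≤ empCDF p t} :=
  ⟨1, fun _ ht => ht.1.2⟩

lemma zero_mem_bhSet (p : Fin m → ℝ) :
    (0 : ℝ) ∈ {t : ℝ | t ∈ Icc (0 : ℝ) 1 ∧ t / α ≤ empCDF p t} :=
  ⟨by simp, by simpa using empCDF_nonneg p 0⟩

lemma le_bhThreshold {p : Fin m → ℝ} {t : ℝ} (ht : t ∈ Icc (0 : ℝ) 1)
    (h : t / α ≤ empCDF p t) : t ≤ bhThreshold α p :=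
  le_csSup (bddAbove_bhSet p) ⟨ht, h⟩

lemma bhThreshold_mem_Icc (p : Fin m → ℝ) : bhThreshold α p ∈ Icc (0 : ℝ) 1 :=
  ⟨le_csSup (bddAbove_bhSet p) (zero_mem_bhSet p),
    csSup_le ⟨0, zero_mem_bhSet p⟩ fun _ ht => ht.1.2⟩

/-- The Benjamini-Hochberg threshold is a crossing point of the empirical c.d.f. -/
lemma bhThreshold_eq (hα : α ∈ Ioc (0 : ℝ) 1) (p : Fin m → ℝ) :
    bhThreshold α p = α * empCDF p (bhThreshold α p) := by
  have hle : bhThreshold α p ≤ α * empCDF p (bhThreshold α p) := by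
    refine csSup_le ⟨0, zero_mem_bhSet p⟩ fun t ht => ?_
    rw [← div_le_iff₀' hα.1]
    exact ht.2.trans (empCDF_mono p (le_csSup (bddAbove_bhSet p) ht))
  -- By `hle` and monotonicity of the empirical c.d.f., `α Ĝ(bh)` is itself feasible, so it cannot
  -- exceed the supremum.
  refine le_antisymm hle (le_bhThreshold ⟨mul_nonneg hα.1.le (empCDF_nonneg _ _),
    mul_le_one₀ hα.2 (empCDF_nonneg _ _) (empCDF_le_one _ _)⟩ ?_)
  rw [mul_div_cancel_left₀ _ hα.1.ne']
  exact empCDF_mono p hle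

lemma bhThreshold_anti (hα : α ∈ Ioc (0 : ℝ) 1) {p p' : Fin m → ℝ} (h : ∀ i, p' i ≤ p i) :
    bhThreshold α p ≤ bhThreshold α p' := by
  refine le_bhThreshold (bhThreshold_mem_Icc p) ?_
  rw [div_le_iff₀' hα.1]
  refine (bhThreshold_eq hα p).le.trans ?_
  have := hα.1.le
  gcongr
  exact empCDF_le_empCDF fun i hi => (h i).trans hi

/-- If `p_i` is at most the threshold computed with `p_i` set to `0`, undoing the change leaves the
count at that threshold unaltered, so it is feasible for `p`. The converse is monotonicity. -/
lemma le_bhThreshold_iff_update (hα : α ∈ Ioc (0 : ℝ) 1) {p : Fin m → ℝ} {i : Fin m}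
    (hp : 0 ≤ p i) :
    p i ≤ bhThreshold α p ↔ p i ≤ bhThreshold α (Function.update p i 0) := by
  constructor
  · refine fun h => h.trans (bhThreshold_anti hα fun j => ?_)
    rcases eq_or_ne j i with rfl | hj
    · simpa using hp
    · simp [hj]
  · refine fun h => h.trans (le_bhThreshold (bhThreshold_mem_Icc _) ?_)
    rw [div_le_iff₀' hα.1]
    refine (bhThreshold_eq hα _).le.trans ?_
    have := hα.1.le
    gcongr
    refine empCDF_le_empCDF fun j hj => ?_
    rcases eq_or_ne j i with rfl | hji
    · exact h
    · simpa [hji] using hj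

/-- One nonpositive `p`-value already makes `Ĝ ≥ 1/m`. Hence zeroing a `p`-value absorbs the
Bonferroni floor. -/
lemma div_le_bhThreshold (hα : α ∈ Ioc (0 : ℝ) 1) {p : Fin m → ℝ} {i : Fin m} (hp : p i ≤ 0) :
    α / m ≤ bhThreshold α p := by
  have hm : (1 : ℝ) ≤ m := by exact_mod_cast i.pos
  have h0 : (0 : ℝ) ≤ α / m := div_nonneg hα.1.le (by linarith)
  refine le_bhThreshold ⟨h0, div_le_one_of_le₀ (hα.2.trans hm) (by linarith)⟩ ?_
  have h1 : α / m / α = (m : ℝ)⁻¹ * 1 := by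
    have := hα.1.ne'
    field_simp
  rw [h1]
  unfold empCDF
  gcongr
  exact_mod_cast Finset.card_pos.2 ⟨i, by simpa using hp.trans h0⟩

lemma fdrThreshold_le_update (hα : α ∈ Ioc (0 : ℝ) 1) {p : Fin m → ℝ} {i : Fin m}
    (hp : 0 ≤ p i) : fdrThreshold α p ≤ bhThreshold α (Function.update p i 0) := by
  refine max_le (bhThreshold_anti hα fun j => ?_) (div_le_bhThreshold hα (i := i) (by simp))
  rcases eq_or_ne j i with rfl | hj
  · simpa using hp
  · simp [hj]

/-- Leave-one-out form of the rejection event of the FDR threshold. -/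
lemma le_fdrThreshold_iff_update (hα : α ∈ Ioc (0 : ℝ) 1) {p : Fin m → ℝ} {i : Fin m}
    (hp : 0 ≤ p i) :
    p i ≤ fdrThreshold α p ↔ p i ≤ bhThreshold α (Function.update p i 0) :=
  ⟨fun h => h.trans (fdrThreshold_le_update hα hp),
    fun h => ((le_bhThreshold_iff_update hα hp).2 h).trans (le_max_left _ _)⟩

lemma measurable_empCDF (t : ℝ) : Measurable fun p : Fin m → ℝ => empCDF p t := by
  unfold empCDF
  refine Measurable.const_mul ?_ _
  simp only [Finset.card_filter, Nat.cast_sum]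
  refine Finset.measurable_fun_sum _ fun i _ => ?_
  have hs : MeasurableSet {p : Fin m → ℝ | p i ≤ t} :=
    measurableSet_le (measurable_pi_apply i) measurable_const
  simp only [Nat.cast_ite, Nat.cast_one, Nat.cast_zero]
  exact Measurable.ite hs measurable_const measurable_const

lemma measurable_bhThreshold (hα : α ∈ Ioc (0 : ℝ) 1) :
    Measurable fun p : Fin m → ℝ => bhThreshold α p := by
  refine measurable_of_Ici fun a => ?_
  -- The crossing equation confines the threshold to the values `α k / m` with `k ≤ m`, so countably
  -- many feasibility tests decide the event.
  have hset : (fun p : Fin m → ℝ => bhThreshold α p) ⁻¹' Ici a =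
      ⋃ k ∈ {k : ℕ | k ≤ m ∧ a ≤ α * ((m : ℝ)⁻¹ * k)},
        {p : Fin m → ℝ | (m : ℝ)⁻¹ * k ≤ empCDF p (α * ((m : ℝ)⁻¹ * k))} := by
    ext p
    simp only [mem_preimage, mem_Ici, mem_iUnion, mem_ofPred_eq, exists_prop]
    constructor
    · intro h
      refine ⟨(Finset.univ.filter fun i => p i ≤ bhThreshold α p).card, ⟨?_, ?_⟩, ?_⟩
      · exact (Finset.card_filter_le _ _).trans_eq (by simp)
      · exact h.trans (bhThreshold_eq hα p).le
      · exact (congrArg (empCDF p) (bhThreshold_eq hα p)).le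
    · rintro ⟨k, ⟨hk, hak⟩, h⟩
      have hk1 : (m : ℝ)⁻¹ * k ≤ 1 := by
        rw [inv_mul_eq_div]
        exact div_le_one_of_le₀ (by exact_mod_cast hk) (by positivity)
      refine hak.trans (le_bhThreshold ⟨mul_nonneg hα.1.le (by positivity),
        mul_le_one₀ hα.2 (by positivity) hk1⟩ ?_)
      rwa [mul_div_cancel_left₀ _ hα.1.ne']
  rw [hset]
  exact MeasurableSet.biUnion (to_countable _) fun k _ =>
    measurableSet_le measurable_const (measurable_empCDF _)

lemma measurable_fdrThreshold (hα : α ∈ Ioc (0 : ℝ) 1) :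
    Measurable fun p : Fin m → ℝ => fdrThreshold α p :=
  (measurable_bhThreshold hα).max measurable_const

end BenjaminiHochberg

/-! ### Conditioning on all coordinates but one, by resampling it. -/

section Resampling

variable {ι E : Type*} [DecidableEq ι] [MeasurableSpace E]

lemma measurable_uncurry_update (j : ι) :
    Measurable fun zw : (ι → E) × E => Function.update zw.1 j zw.2 := by
  refine measurable_pi_lambda _ fun i => ?_
  rcases eq_or_ne i j with rfl | h
  · simpa using measurable_snd
  · simp only [Function.update_of_ne h]
    fun_prop

variable [Fintype ι] {Q : Measure E} [IsProbabilityMeasure Q]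

/-- Resampling one coordinate preserves a product law. -/
lemma measurePreserving_update (j : ι) :
    MeasurePreserving (fun zw : (ι → E) × E => Function.update zw.1 j zw.2)
      ((Measure.pi fun _ => Q).prod Q) (Measure.pi fun _ => Q) := by
  refine ⟨measurable_uncurry_update j, (Measure.pi_eq fun s hs => ?_).symm⟩
  rw [Measure.map_apply (measurable_uncurry_update j) (MeasurableSet.univ_pi hs)]
  have hpre : (fun zw : (ι → E) × E => Function.update zw.1 j zw.2) ⁻¹' univ.pi s =
      (univ.pi (Function.update s j univ)) ×ˢ s j := by
    ext ⟨z, w⟩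
    simp only [mem_preimage, mem_univ_pi, mem_prod]
    constructor
    · refine fun h => ⟨fun i => ?_, by simpa using h j⟩
      rcases eq_or_ne i j with rfl | hi
      · simp
      · simpa [hi] using h i
    · rintro ⟨h, hw⟩ i
      rcases eq_or_ne i j with rfl | hi
      · simpa using hw
      · simpa [hi] using h i
  rw [hpre, Measure.prod_prod, Measure.pi_pi,
    ← Finset.prod_erase_mul Finset.univ (fun i => Q (s i)) (Finset.mem_univ j),
    ← Finset.prod_erase_mul Finset.univ (fun i => Q (Function.update s j univ i))
      (Finset.mem_univ j)]
  simp only [Function.update_self, measure_univ, mul_one]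
  congr 1
  refine Finset.prod_congr rfl fun i hi => ?_
  rw [Function.update_of_ne (Finset.ne_of_mem_erase hi)]

/-- Fubini after resampling coordinate `j`; it plays the role of conditioning on the other
coordinates. -/
lemma measureReal_le_integral_of_update_le (j : ι) {S : Set (ι → E)} (hS : MeasurableSet S)
    {f : (ι → E) → ℝ} (hf : Integrable f (Measure.pi fun _ => Q))
    (h : ∀ z, Q.real {w | Function.update z j w ∈ S} ≤ f z) :
    (Measure.pi fun _ => Q).real S ≤ ∫ z, f z ∂(Measure.pi fun _ => Q) := by
  have h0 : ∀ z, 0 ≤ f z := fun z => measureReal_nonneg.trans (h z)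
  rw [measureReal_def, ← (measurePreserving_update (Q := Q) j).measure_preimage
    hS.nullMeasurableSet, Measure.prod_apply (measurable_uncurry_update j hS)]
  refine ENNReal.toReal_le_of_le_ofReal (integral_nonneg h0) ?_
  rw [ofReal_integral_eq_lintegral_ofReal hf (ae_of_all _ h0)]
  refine lintegral_mono fun z => ?_
  rw [← ENNReal.ofReal_toReal (measure_ne_top Q _)]
  exact ENNReal.ofReal_le_ofReal (h z)

end Resampling

/-- Follows from `1 + x + x²/2 ≤ e ^ x`, because `(1 + x + x²/2)(1 - x + x²/2) = 1 + x⁴/4 ≥ 1`. -/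
lemma exp_neg_le_quadratic {x : ℝ} (hx : 0 ≤ x) : Real.exp (-x) ≤ 1 - x + x ^ 2 / 2 := by
  have h := Real.quadratic_le_exp_of_nonneg hx
  have hpos : 0 < 1 - x + x ^ 2 / 2 := by nlinarith [sq_nonneg (x - 1)]
  rw [Real.exp_neg, inv_le_comm₀ (Real.exp_pos x) hpos]
  refine le_trans ?_ h
  rw [inv_le_iff_one_le_mul₀ hpos]
  nlinarith [sq_nonneg (x ^ 2)]

/-! ### The labelled sample: single-coordinate bounds, mean BH threshold, Chernoff. -/

namespace Model

variable {M : Model}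

lemma prob0_nonneg (hM : M.Admissible) : 0 ≤ M.prob0 := by
  have := hM.1
  exact div_nonneg (by linarith) (by linarith)

lemma prob1_pos (hM : M.Admissible) : 0 < M.prob1 := by
  have := hM.1
  exact div_pos one_pos (by linarith)

lemma prob0_add_prob1 (hM : M.Admissible) : M.prob0 + M.prob1 = 1 := by
  have : 1 + M.τ ≠ 0 := by linarith [hM.1]
  unfold prob0 prob1
  field_simp
  ring

lemma prob0_eq (M : Model) : M.prob0 = M.τ * M.prob1 := by
  unfold prob0 prob1
  ring

lemma pairLaw_apply (M : Model) {S : Set (ℝ × Bool)} (hS : MeasurableSet S) :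
    M.pairLaw S = ENNReal.ofReal M.prob0 * M.nullLaw {x | (x, false) ∈ S} +
      ENNReal.ofReal M.prob1 * M.altLaw {x | (x, true) ∈ S} := by
  unfold pairLaw
  rw [Measure.add_apply, Measure.smul_apply, Measure.smul_apply,
    Measure.map_apply (by fun_prop) hS, Measure.map_apply (by fun_prop) hS]
  rfl

lemma isProbabilityMeasure_pairLaw (hM : M.Admissible) : IsProbabilityMeasure M.pairLaw := by
  have := isProbabilityMeasure_nullLaw hM
  have := isProbabilityMeasure_altLaw hM
  constructor
  rw [pairLaw_apply M MeasurableSet.univ]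
  simp only [mem_univ, ofPred_true, measure_univ, mul_one]
  rw [← ENNReal.ofReal_add (prob0_nonneg hM) (prob1_pos hM).le, prob0_add_prob1 hM,
    ENNReal.ofReal_one]

lemma pairLaw_real_apply (hM : M.Admissible) {S : Set (ℝ × Bool)} (hS : MeasurableSet S) :
    M.pairLaw.real S = M.prob0 * M.nullLaw.real {x | (x, false) ∈ S} +
      M.prob1 * M.altLaw.real {x | (x, true) ∈ S} := by
  have := isProbabilityMeasure_nullLaw hM
  have := isProbabilityMeasure_altLaw hM
  rw [measureReal_def, pairLaw_apply M hS, ENNReal.toReal_add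
    (ENNReal.mul_ne_top ENNReal.ofReal_ne_top (measure_ne_top _ _))
    (ENNReal.mul_ne_top ENNReal.ofReal_ne_top (measure_ne_top _ _)),
    ENNReal.toReal_mul, ENNReal.toReal_mul, ENNReal.toReal_ofReal (prob0_nonneg hM),
    ENNReal.toReal_ofReal (prob1_pos hM).le]
  rfl

lemma measurable_pValue_fst (hM : M.Admissible) :
    Measurable fun w : ℝ × Bool => M.pValue w.1 :=
  (measurable_pValue hM).comp measurable_fst

lemma measurableSet_label (b : Bool) : MeasurableSet {w : ℝ × Bool | w.2 = b} :=
  measurable_snd (measurableSet_singleton b)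

lemma pairLaw_real_label_true (hM : M.Admissible) :
    M.pairLaw.real {w | w.2 = true} = M.prob1 := by
  have := isProbabilityMeasure_altLaw hM
  rw [pairLaw_real_apply hM (measurableSet_label true)]
  simp

lemma pairLaw_real_falsePos (hM : M.Admissible) (t : ℝ) :
    M.pairLaw.real {w | M.pValue w.1 ≤ t ∧ w.2 = false} =
      M.prob0 * M.nullLaw.real {x | M.pValue x ≤ t} := by
  have hS : MeasurableSet {w : ℝ × Bool | M.pValue w.1 ≤ t ∧ w.2 = false} :=
    (measurableSet_le (measurable_pValue_fst hM) measurable_const).inter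
      (measurableSet_label false)
  rw [pairLaw_real_apply hM hS]
  simp

lemma pairLaw_real_falseNeg (hM : M.Admissible) (t : ℝ) :
    M.pairLaw.real {w | t < M.pValue w.1 ∧ w.2 = true} = M.prob1 * (1 - M.altCDF t) := by
  have := isProbabilityMeasure_altLaw hM
  have hS : MeasurableSet {w : ℝ × Bool | t < M.pValue w.1 ∧ w.2 = true} :=
    (measurableSet_lt measurable_const (measurable_pValue_fst hM)).inter
      (measurableSet_label true)
  rw [pairLaw_real_apply hM hS]
  have h : {x | t < M.pValue x} = {x | M.pValue x ≤ t}ᶜ := by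
    ext x
    simp
  have hs : MeasurableSet {x | M.pValue x ≤ t} :=
    measurableSet_le (measurable_pValue hM) measurable_const
  simp only [mem_ofPred_eq, Bool.false_eq_true, and_false, ofPred_false, measureReal_empty,
    mul_zero, zero_add, and_true]
  rw [h, probReal_compl_eq_one_sub hs]
  rfl

lemma pairLaw_real_pValue_le (hM : M.Admissible) (t : ℝ) :
    M.pairLaw.real {w | M.pValue w.1 ≤ t} =
      M.prob0 * M.nullLaw.real {x | M.pValue x ≤ t} + M.prob1 * M.altCDF t := by
  rw [pairLaw_real_apply hM (measurableSet_le (measurable_pValue_fst hM) measurable_const)]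
  rfl

/-- The law of the `n` labelled observations. -/
noncomputable abbrev sampleLaw (M : Model) (n : ℕ) : Measure (Fin n → ℝ × Bool) :=
  Measure.pi fun _ => M.pairLaw

/-- The sample `p`-values, with those indexed by `S` replaced by `0`. -/
noncomputable def zeroedPValues (M : Model) {m : ℕ} (S : Finset (Fin m)) (z : Fin (m + 1) → ℝ × Bool) :
    Fin m → ℝ :=
  fun i => if i ∈ S then 0 else M.pValue (z i.castSucc).1

section Sample

variable {m : ℕ} {α : ℝ}

lemma measurable_zeroedPValues (hM : M.Admissible) (S : Finset (Fin m)) :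
    Measurable (M.zeroedPValues S) := by
  refine measurable_pi_lambda _ fun i => ?_
  unfold zeroedPValues
  split_ifs
  · exact measurable_const
  · exact (measurable_pValue_fst hM).comp (measurable_pi_apply i.castSucc)

lemma zeroedPValues_empty (z : Fin (m + 1) → ℝ × Bool) :
    M.zeroedPValues ∅ z = fun i : Fin m => M.pValue (z i.castSucc).1 := by
  ext i
  simp [zeroedPValues]

lemma zeroedPValues_insert (S : Finset (Fin m)) (i : Fin m) (z : Fin (m + 1) → ℝ × Bool) :
    M.zeroedPValues (insert i S) z = Function.update (M.zeroedPValues S z) i 0 := by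
  ext j
  rcases eq_or_ne j i with rfl | h <;> simp [zeroedPValues, *]

lemma zeroedPValues_update {S : Finset (Fin m)} {i : Fin m} (hi : i ∈ S)
    (z : Fin (m + 1) → ℝ × Bool) (w : ℝ × Bool) :
    M.zeroedPValues S (Function.update z i.castSucc w) = M.zeroedPValues S z := by
  ext j
  rcases eq_or_ne j i with rfl | h
  · simp [zeroedPValues, hi]
  · simp [zeroedPValues, h]

lemma zeroedPValues_update_last (S : Finset (Fin m)) (z : Fin (m + 1) → ℝ × Bool)
    (w : ℝ × Bool) :
    M.zeroedPValues S (Function.update z (Fin.last m) w) = M.zeroedPValues S z := by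
  ext j
  simp [zeroedPValues, (Fin.castSucc_lt_last j).ne]

lemma integrable_of_mem_Icc (hM : M.Admissible) {n : ℕ} {T : (Fin n → ℝ × Bool) → ℝ}
    (hT : Measurable T) (h01 : ∀ z, T z ∈ Icc (0 : ℝ) 1) : Integrable T (M.sampleLaw n) := by
  have := isProbabilityMeasure_pairLaw hM
  refine Integrable.of_bound hT.aestronglyMeasurable 1 (ae_of_all _ fun z => ?_)
  rw [Real.norm_eq_abs, abs_of_nonneg (h01 z).1]
  exact (h01 z).2

lemma measurable_pValue_coord (hM : M.Admissible) {n : ℕ} (j : Fin n) :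
    Measurable fun z : Fin n → ℝ × Bool => M.pValue (z j).1 :=
  (measurable_pValue_fst hM).comp (measurable_pi_apply j)

lemma measurableSet_label_coord {n : ℕ} (j : Fin n) (b : Bool) :
    MeasurableSet {z : Fin n → ℝ × Bool | (z j).2 = b} :=
  measurableSet_eq_fun (measurable_snd.comp (measurable_pi_apply j)) measurable_const

lemma sampleLaw_falsePos_le (hM : M.Admissible) {n : ℕ} (j : Fin n)
    {T : (Fin n → ℝ × Bool) → ℝ} (hT : Measurable T) (h01 : ∀ z, T z ∈ Icc (0 : ℝ) 1)
    (hinv : ∀ z w, T (Function.update z j w) = T z) :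
    (M.sampleLaw n).real {z | M.pValue (z j).1 ≤ T z ∧ (z j).2 = false} ≤
      M.prob0 * ∫ z, T z ∂(M.sampleLaw n) := by
  have := isProbabilityMeasure_pairLaw hM
  have hS : MeasurableSet {z : Fin n → ℝ × Bool | M.pValue (z j).1 ≤ T z ∧ (z j).2 = false} :=
    (measurableSet_le (measurable_pValue_coord hM j) hT).inter (measurableSet_label_coord j false)
  rw [← integral_const_mul]
  refine measureReal_le_integral_of_update_le j hS ((integrable_of_mem_Icc hM hT h01).const_mul _) fun z => ?_
  simp only [mem_ofPred_eq, Function.update_self, hinv]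
  rw [pairLaw_real_falsePos hM]
  exact mul_le_mul_of_nonneg_left (nullLaw_pValue_le_le hM (h01 z).1) (prob0_nonneg hM)

/-- Null rejections cost the threshold itself; label-`1` rejections are all counted, at cost `π₁`.
This is the one-step bound of the recursion for the mean BH threshold. -/
lemma sampleLaw_pos_le (hM : M.Admissible) {n : ℕ} (j : Fin n)
    {T : (Fin n → ℝ × Bool) → ℝ} (hT : Measurable T) (h01 : ∀ z, T z ∈ Icc (0 : ℝ) 1)
    (hinv : ∀ z w, T (Function.update z j w) = T z) :
    (M.sampleLaw n).real {z | M.pValue (z j).1 ≤ T z} ≤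
      M.prob0 * ∫ z, T z ∂(M.sampleLaw n) + M.prob1 := by
  have := isProbabilityMeasure_pairLaw hM
  have := isProbabilityMeasure_altLaw hM
  have hint := (integrable_of_mem_Icc hM hT h01).const_mul M.prob0
  have h1 : M.prob0 * ∫ z, T z ∂(M.sampleLaw n) + M.prob1 =
      ∫ z, (M.prob0 * T z + M.prob1) ∂(M.sampleLaw n) := by
    rw [integral_add hint (integrable_const _), integral_const_mul]
    simp
  rw [h1]
  refine measureReal_le_integral_of_update_le j (measurableSet_le (measurable_pValue_coord hM j)
    hT) (hint.add (integrable_const _)) fun z => ?_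
  simp only [mem_ofPred_eq, Function.update_self, hinv]
  rw [pairLaw_real_pValue_le hM]
  refine add_le_add (mul_le_mul_of_nonneg_left (nullLaw_pValue_le_le hM (h01 z).1)
    (prob0_nonneg hM)) (mul_le_of_le_one_right (prob1_pos hM).le measureReal_le_one)

lemma sampleLaw_label_true_le (hM : M.Admissible) {n : ℕ} (j : Fin n)
    {A : Set (Fin n → ℝ × Bool)} (hA : MeasurableSet A)
    (hinv : ∀ z w, Function.update z j w ∈ A ↔ z ∈ A) :
    (M.sampleLaw n).real (A ∩ {z | (z j).2 = true}) ≤ M.prob1 * (M.sampleLaw n).real A := by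
  have := isProbabilityMeasure_pairLaw hM
  rw [← integral_indicator_one hA, ← integral_const_mul]
  refine measureReal_le_integral_of_update_le j (hA.inter (measurableSet_label_coord j true))
    (((integrable_const (1 : ℝ)).indicator hA).const_mul _) fun z => ?_
  simp only [mem_inter_iff, mem_ofPred_eq, Function.update_self, hinv]
  by_cases hz : z ∈ A
  · simp [hz, pairLaw_real_label_true hM]
  · simp [hz]

lemma sampleLaw_real_coord (hM : M.Admissible) {n : ℕ} (j : Fin n) {S : Set (ℝ × Bool)}
    (hS : MeasurableSet S) : (M.sampleLaw n).real {z | z j ∈ S} = M.pairLaw.real S := by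
  have := isProbabilityMeasure_pairLaw hM
  exact (measurePreserving_eval (fun _ : Fin n => M.pairLaw) j).measureReal_preimage
    hS.nullMeasurableSet

/-- The expected Benjamini-Hochberg threshold when the `p`-values indexed by `S` are set to `0`. -/
lemma integral_bhThreshold_le (hM : M.Admissible) (hm : 0 < m) (hα : α ∈ Ioo (0 : ℝ) 1)
    (S : Finset (Fin m)) :
    ∫ z, bhThreshold α (M.zeroedPValues S z) ∂(M.sampleLaw (m + 1)) ≤
      α / m * ((S.card + m * M.prob1) / (1 - α) + α / (1 - α) ^ 2) := by
  have := isProbabilityMeasure_pairLaw hM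
  have hα' : α ∈ Ioc (0 : ℝ) 1 := ⟨hα.1, hα.2.le⟩
  have hα1 : 0 < 1 - α := sub_pos.2 hα.2
  have hm0 : (0 : ℝ) < m := by exact_mod_cast hm
  have hmeas : ∀ S : Finset (Fin m),
      Measurable fun z => bhThreshold α (M.zeroedPValues S z) := fun S =>
    (measurable_bhThreshold hα').comp (measurable_zeroedPValues hM S)
  -- Induction on the number of `p`-values not yet zeroed: the bound for `S` uses the bounds for
  -- `insert i S`.
  induction hn : Sᶜ.card using Nat.strong_induction_on generalizing S with
  | _ n ih =>
  have hset : ∀ i, MeasurableSet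
      {z | M.zeroedPValues S z i ≤ bhThreshold α (M.zeroedPValues S z)} := fun i =>
    measurableSet_le ((measurable_pi_apply i).comp (measurable_zeroedPValues hM S)) (hmeas S)
  have hsum : ∫ z, bhThreshold α (M.zeroedPValues S z) ∂(M.sampleLaw (m + 1)) =
      α / m * ∑ i, (M.sampleLaw (m + 1)).real
        {z | M.zeroedPValues S z i ≤ bhThreshold α (M.zeroedPValues S z)} := by
    have h1 : ∀ z, bhThreshold α (M.zeroedPValues S z) = α / m * ∑ i,
        indicator {z | M.zeroedPValues S z i ≤ bhThreshold α (M.zeroedPValues S z)} 1 z := by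
      intro z
      rw [bhThreshold_eq hα']
      unfold empCDF
      rw [Finset.card_filter, Nat.cast_sum, ← mul_assoc, div_eq_mul_inv]
      congr 1
      refine Finset.sum_congr rfl fun i _ => ?_
      simp only [indicator_apply, mem_ofPred_eq, Pi.one_apply]
      split_ifs <;> simp
    rw [integral_congr_ae (ae_of_all _ h1), integral_const_mul, integral_finsetSum]
    · simp only [integral_indicator_one (hset _)]
    · exact fun i _ => (integrable_const (1 : ℝ)).indicator (hset i)
  -- The inductive bound for a set with one more element.
  set B : ℝ := α / m * ((S.card + 1 + m * M.prob1) / (1 - α) + α / (1 - α) ^ 2) with hB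
  have hπ := prob1_pos hM
  have hB0 : 0 ≤ B := by
    have := hα.1
    positivity
  have hterm : ∀ i, (M.sampleLaw (m + 1)).real
      {z | M.zeroedPValues S z i ≤ bhThreshold α (M.zeroedPValues S z)} ≤
        (if i ∈ S then 1 else 0) + (B + M.prob1) := by
    intro i
    by_cases hi : i ∈ S
    · rw [if_pos hi]
      have : (M.sampleLaw (m + 1)).real
        {z | M.zeroedPValues S z i ≤ bhThreshold α (M.zeroedPValues S z)} ≤ 1 := measureReal_le_one
      linarith
    · rw [if_neg hi, zero_add]
      have heq : {z | M.zeroedPValues S z i ≤ bhThreshold α (M.zeroedPValues S z)} =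
          {z | M.pValue (z i.castSucc).1 ≤ bhThreshold α (M.zeroedPValues (insert i S) z)} := by
        ext z
        have hzi : M.zeroedPValues S z i = M.pValue (z i.castSucc).1 := by
          simp [zeroedPValues, hi]
        simp only [mem_ofPred_eq]
        rw [zeroedPValues_insert, le_bhThreshold_iff_update hα'
          (by rw [hzi]; exact (pValue_pos hM _).le), hzi]
      rw [heq]
      refine (sampleLaw_pos_le hM i.castSucc (hmeas _) (fun z => bhThreshold_mem_Icc _)
        fun z w => by rw [zeroedPValues_update (Finset.mem_insert_self i S)]).trans ?_
      have hcard : (insert i S)ᶜ.card < n := by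
        rw [← hn]
        refine Finset.card_lt_card (Finset.compl_ssubset_compl.2 (Finset.ssubset_insert hi))
      have h2 := ih _ hcard (insert i S) rfl
      rw [Finset.card_insert_of_notMem hi, Nat.cast_add, Nat.cast_one, ← hB] at h2
      have h3 : 0 ≤ ∫ z, bhThreshold α (M.zeroedPValues (insert i S) z)
          ∂(M.sampleLaw (m + 1)) := integral_nonneg fun z => (bhThreshold_mem_Icc _).1
      have h4 : M.prob0 ≤ 1 := by linarith [prob0_add_prob1 hM]
      have h5 := mul_le_mul h4 h2 h3 zero_le_one
      linarith
  rw [hsum]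
  have hα0 := hα.1
  -- `B + π₁` is charged to all `m` indices, also those in `S`; with this slack the recursion closes
  -- with equality.
  refine (mul_le_mul_of_nonneg_left (Finset.sum_le_sum fun i _ => hterm i)
    (by positivity)).trans_eq ?_
  rw [Finset.sum_add_distrib, Finset.sum_const, Finset.card_univ, Fintype.card_fin,
    nsmul_eq_mul, Finset.sum_boole, Finset.filter_mem_eq_inter, Finset.univ_inter, hB]
  field_simp
  ring

/-- Multiplicative Chernoff bound for the lower deviations of the empirical c.d.f. -/
lemma sampleLaw_empCDF_le (hM : M.Admissible) {t c ε : ℝ} (hε : 0 ≤ ε)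
    (hc : c ≤ M.pairLaw.real {w | M.pValue w.1 ≤ t}) (hε1 : ε ≤ 1) :
    (M.sampleLaw (m + 1)).real
      {z | empCDF (fun i : Fin m => M.pValue (z i.castSucc).1) t ≤ (1 - ε) * c} ≤
        Real.exp (-(m * c * ε ^ 2 / 2)) := by
  have := isProbabilityMeasure_pairLaw hM
  set g := M.pairLaw.real {w | M.pValue w.1 ≤ t} with hg
  have hs : MeasurableSet {w : ℝ × Bool | M.pValue w.1 ≤ t} :=
    measurableSet_le (measurable_pValue_fst hM) measurable_const
  let Y : Fin (m + 1) → (Fin (m + 1) → ℝ × Bool) → ℝ := fun j z =>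
    indicator {w : ℝ × Bool | M.pValue w.1 ≤ t} 1 (z j)
  have hYm : ∀ j, Measurable (Y j) := fun j =>
    (measurable_one.indicator hs).comp (measurable_pi_apply j)
  have hind : iIndepFun Y (M.sampleLaw (m + 1)) :=
    iIndepFun_pi (X := fun _ => indicator {w : ℝ × Bool | M.pValue w.1 ≤ t} (1 : ℝ × Bool → ℝ))
      fun _ => (measurable_one.indicator hs).aemeasurable
  have hmgf : ∀ j, mgf (Y j) (M.sampleLaw (m + 1)) (-ε) = 1 + (Real.exp (-ε) - 1) * g := by
    intro j
    have hpre : MeasurableSet {z : Fin (m + 1) → ℝ × Bool | M.pValue (z j).1 ≤ t} :=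
      measurableSet_le (measurable_pValue_coord hM j) measurable_const
    have h1 : ∀ z, Real.exp (-ε * Y j z) = 1 + (Real.exp (-ε) - 1) *
        indicator {z : Fin (m + 1) → ℝ × Bool | M.pValue (z j).1 ≤ t} 1 z := by
      intro z
      by_cases hz : M.pValue (z j).1 ≤ t <;> simp [Y, indicator_apply, hz]
    have hI : Integrable (indicator {z : Fin (m + 1) → ℝ × Bool | M.pValue (z j).1 ≤ t}
        (1 : (Fin (m + 1) → ℝ × Bool) → ℝ)) (M.sampleLaw (m + 1)) :=
      (integrable_const (1 : ℝ)).indicator hpre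
    unfold mgf
    rw [integral_congr_ae (ae_of_all _ h1), integral_add (integrable_const _)
      (hI.const_mul _), integral_const_mul,
      integral_indicator_one hpre]
    have h2 : (M.sampleLaw (m + 1)).real {z | M.pValue (z j).1 ≤ t} = g :=
      sampleLaw_real_coord hM j hs
    rw [h2]
    simp
  let s : Finset (Fin (m + 1)) := Finset.univ.map Fin.castSuccEmb
  have hY0 : ∀ j z, 0 ≤ Y j z := fun j z => indicator_nonneg (fun _ _ => zero_le_one) _
  have hint : Integrable (fun z => Real.exp (-ε * (∑ j ∈ s, Y j) z)) (M.sampleLaw (m + 1)) := by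
    have hmeas : Measurable fun z => Real.exp (-ε * (∑ j ∈ s, Y j) z) := by
      simp only [Finset.sum_apply]
      exact Real.measurable_exp.comp
        ((Finset.measurable_fun_sum s fun j _ => hYm j).const_mul _)
    refine Integrable.of_bound hmeas.aestronglyMeasurable 1
      (ae_of_all _ fun z => ?_)
    rw [Real.norm_eq_abs, Real.abs_exp, Real.exp_le_one_iff, Finset.sum_apply]
    have := Finset.sum_nonneg fun j (_ : j ∈ s) => hY0 j z
    nlinarith
  -- The parameter `-ε` replaces the optimal `log (1 - ε)`: with the quadratic bound on `e ^ (-ε)`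
  -- the exponent is `m c (ε (1 - ε) - ε + ε²/2) = -m c ε²/2`.
  have hbound := measure_le_le_exp_mul_mgf (μ := M.sampleLaw (m + 1)) (X := ∑ j ∈ s, Y j)
    (m * ((1 - ε) * c)) (neg_nonpos.2 hε) hint
  have hincl : {z | empCDF (fun i : Fin m => M.pValue (z i.castSucc).1) t ≤ (1 - ε) * c} ⊆
      {z | (∑ j ∈ s, Y j) z ≤ m * ((1 - ε) * c)} := by
    intro z hz
    have hsum : (∑ j ∈ s, Y j) z =
        m * empCDF (fun i : Fin m => M.pValue (z i.castSucc).1) t := by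
      unfold empCDF
      rcases Nat.eq_zero_or_pos m with rfl | hm
      · simp [s]
      have hm0 : (m : ℝ) ≠ 0 := by exact_mod_cast hm.ne'
      rw [mul_inv_cancel_left₀ hm0, Finset.card_filter, Nat.cast_sum, Finset.sum_apply,
        Finset.sum_map]
      refine Finset.sum_congr rfl fun i _ => ?_
      simp [Y, indicator_apply]
    change (∑ j ∈ s, Y j) z ≤ m * ((1 - ε) * c)
    rw [hsum]
    exact mul_le_mul_of_nonneg_left hz (Nat.cast_nonneg m)
  refine (measureReal_mono hincl).trans (hbound.trans ?_)
  rw [hind.mgf_sum hYm, Finset.prod_congr rfl fun j _ => hmgf j, Finset.prod_const,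
    Finset.card_map, Finset.card_univ, Fintype.card_fin]
  have hq := exp_neg_le_quadratic hε
  have hg0 : 0 ≤ g := measureReal_nonneg
  have hg1 : g ≤ 1 := measureReal_le_one
  have he := Real.exp_pos (-ε)
  have h1 : 1 + (Real.exp (-ε) - 1) * g ≤ Real.exp ((Real.exp (-ε) - 1) * g) := by
    linarith [Real.add_one_le_exp ((Real.exp (-ε) - 1) * g)]
  have h0 : 0 ≤ 1 + (Real.exp (-ε) - 1) * g := by nlinarith
  have h2 := pow_le_pow_left₀ h0 h1 m
  rw [← Real.exp_nat_mul] at h2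
  refine (mul_le_mul_of_nonneg_left h2 (Real.exp_pos _).le).trans ?_
  rw [← Real.exp_add, Real.exp_le_exp]
  have h3 : (Real.exp (-ε) - 1) * g ≤ (-ε + ε ^ 2 / 2) * c := by
    have h4 : -ε + ε ^ 2 / 2 ≤ 0 := by nlinarith
    nlinarith
  have h5 := mul_le_mul_of_nonneg_left h3 (Nat.cast_nonneg (α := ℝ) m)
  nlinarith

end Sample

end Model

/-! ### Risk bounds for the BFDR and FDR thresholds. -/

namespace Model

variable {M : Model} {m : ℕ} {α : ℝ}

/-- The probability that the `j`-th observation is misclassified by the threshold `T`. -/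
noncomputable def errorProb (M : Model) {m : ℕ} (T : (Fin m → ℝ) → ℝ) (j : Fin (m + 1)) : ℝ :=
  (M.sampleLaw (m + 1)).real
      {z | M.pValue (z j).1 ≤ T (M.zeroedPValues ∅ z) ∧ (z j).2 = false} +
    (M.sampleLaw (m + 1)).real
      {z | T (M.zeroedPValues ∅ z) < M.pValue (z j).1 ∧ (z j).2 = true}

lemma measurableSet_falsePos (hM : M.Admissible) {n : ℕ} {T : (Fin n → ℝ × Bool) → ℝ}
    (hT : Measurable T) (j : Fin n) :
    MeasurableSet {z : Fin n → ℝ × Bool | M.pValue (z j).1 ≤ T z ∧ (z j).2 = false} :=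
  (measurableSet_le (measurable_pValue_coord hM j) hT).inter (measurableSet_label_coord j false)

lemma measurableSet_falseNeg (hM : M.Admissible) {n : ℕ} {T : (Fin n → ℝ × Bool) → ℝ}
    (hT : Measurable T) (j : Fin n) :
    MeasurableSet {z : Fin n → ℝ × Bool | T z < M.pValue (z j).1 ∧ (z j).2 = true} :=
  (measurableSet_lt hT (measurable_pValue_coord hM j)).inter (measurableSet_label_coord j true)

section Risk

variable {Ω : Type*} [MeasurableSpace Ω] {P : Measure Ω} [IsProbabilityMeasure P]
  {X : Fin (m + 1) → Ω → ℝ} {H : Fin (m + 1) → Ω → Bool}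

lemma hasLaw_sample (hXH : IsSample P M X H) :
    HasLaw (fun ω i => (X i ω, H i ω)) (M.sampleLaw (m + 1)) P := by
  have hm : ∀ i, AEMeasurable (fun ω => (X i ω, H i ω)) P := fun i => (hXH.law i).aemeasurable
  refine ⟨aemeasurable_pi_lambda _ hm, ?_⟩
  rw [(iIndepFun_iff_map_fun_eq_pi_map hm).1 hXH.indep]
  simp only [(hXH.law _).map_eq]

lemma risk_eq_errorProb (hM : M.Admissible) (hXH : IsSample P M X H)
    {T : (Fin m → ℝ) → ℝ} (hT : Measurable T) (R : RiskKind) :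
    risk P M X H R T = match R with
      | .transductiveRisk => (m : ℝ)⁻¹ * ∑ i : Fin m, M.errorProb T i.castSucc
      | .inductiveRisk => M.errorProb T (Fin.last m) := by
  have hTz : Measurable fun z => T (M.zeroedPValues ∅ z) :=
    hT.comp (measurable_zeroedPValues hM ∅)
  have herr : ∀ j, P.real {ω | M.pValue (X j ω) ≤ T (fun i => M.pValue (X i.castSucc ω)) ∧
      H j ω = false} + P.real {ω | T (fun i => M.pValue (X i.castSucc ω)) < M.pValue (X j ω) ∧
      H j ω = true} = M.errorProb T j := by
    intro j
    have h1 := (hasLaw_sample hXH).measureReal_eq (measurableSet_falsePos hM hTz j)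
    have h2 := (hasLaw_sample hXH).measureReal_eq (measurableSet_falseNeg hM hTz j)
    simp only [zeroedPValues_empty] at h1 h2
    unfold errorProb
    simp only [zeroedPValues_empty]
    rw [← h1, ← h2]
  cases R <;> simp only [risk, herr]

lemma risk_le_of_errorProb_le (hM : M.Admissible) (hm : 0 < m) (hXH : IsSample P M X H)
    {T : (Fin m → ℝ) → ℝ} (hT : Measurable T) (R : RiskKind) {b : ℝ}
    (hb : ∀ j, M.errorProb T j ≤ b) : risk P M X H R T ≤ b := by
  rw [risk_eq_errorProb hM hXH hT]
  cases R
  · have hm0 : (0 : ℝ) < m := by exact_mod_cast hm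
    simp only
    rw [inv_mul_le_iff₀ hm0]
    refine (Finset.sum_le_card_nsmul _ _ b fun i _ => hb _).trans_eq ?_
    simp
  · exact hb _

lemma errorProb_const (hM : M.Admissible) {t : ℝ} (ht : t ∈ Ioo (0 : ℝ) 1) (j : Fin (m + 1)) :
    M.errorProb (fun _ : Fin m → ℝ => t) j = M.prob0 * t + M.prob1 * (1 - M.altCDF t) := by
  have h1 : MeasurableSet {w : ℝ × Bool | M.pValue w.1 ≤ t ∧ w.2 = false} :=
    (measurableSet_le (measurable_pValue_fst hM) measurable_const).inter
      (measurableSet_label false)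
  have h2 : MeasurableSet {w : ℝ × Bool | t < M.pValue w.1 ∧ w.2 = true} :=
    (measurableSet_lt measurable_const (measurable_pValue_fst hM)).inter
      (measurableSet_label true)
  rw [← pairLaw_real_falseNeg hM, ← nullLaw_pValue_le hM ht, ← pairLaw_real_falsePos hM,
    nullLaw_pValue_le hM ht]
  exact congrArg₂ (· + ·) (sampleLaw_real_coord hM j h1) (sampleLaw_real_coord hM j h2)

lemma risk_const (hM : M.Admissible) (hm : 0 < m) (hXH : IsSample P M X H) (R : RiskKind)
    {t : ℝ} (ht : t ∈ Ioo (0 : ℝ) 1) :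
    risk P M X H R (fun _ => t) = M.prob0 * t + M.prob1 * (1 - M.altCDF t) := by
  rw [risk_eq_errorProb hM hXH measurable_const]
  have hm0 : (m : ℝ) ≠ 0 := by exact_mod_cast hm.ne'
  cases R
  · simp only [errorProb_const hM ht, Finset.sum_const, Finset.card_univ, Fintype.card_fin,
      nsmul_eq_mul]
    rw [inv_mul_cancel_left₀ hm0]
  · exact errorProb_const hM ht _

end Risk

/-- Error bound for a random threshold dominated by a threshold `T₁` that ignores the `j`-th
observation; `T₂` is a second such threshold, governing the false negatives. -/
lemma errorProb_le (hM : M.Admissible) {T : (Fin m → ℝ) → ℝ} {j : Fin (m + 1)}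
    {T₁ T₂ : (Fin (m + 1) → ℝ × Bool) → ℝ} (hT₁ : Measurable T₁) (hT₂ : Measurable T₂)
    (h01 : ∀ z, T₁ z ∈ Icc (0 : ℝ) 1)
    (hinv₁ : ∀ z w, T₁ (Function.update z j w) = T₁ z)
    (hinv₂ : ∀ z w, T₂ (Function.update z j w) = T₂ z)
    (hle : ∀ z, T (M.zeroedPValues ∅ z) ≤ T₂ z)
    (hpos : ∀ z, M.pValue (z j).1 ≤ T (M.zeroedPValues ∅ z) → M.pValue (z j).1 ≤ T₁ z)
    (hneg : ∀ z, T (M.zeroedPValues ∅ z) < M.pValue (z j).1 → T₂ z < M.pValue (z j).1)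
    {t δ : ℝ}
    (hδ : (M.sampleLaw (m + 1)).real {z | T (M.zeroedPValues ∅ z) < t} ≤ δ) :
    M.errorProb T j ≤ M.prob0 * ∫ z, T₁ z ∂(M.sampleLaw (m + 1)) +
      M.prob1 * (1 - M.altCDF t + δ) := by
  have := isProbabilityMeasure_pairLaw hM
  unfold errorProb
  have hsub₁ : {z | M.pValue (z j).1 ≤ T (M.zeroedPValues ∅ z) ∧ (z j).2 = false} ⊆
      {z | M.pValue (z j).1 ≤ T₁ z ∧ (z j).2 = false} := fun z hz => ⟨hpos z hz.1, hz.2⟩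
  refine add_le_add ((measureReal_mono hsub₁).trans
    (sampleLaw_falsePos_le hM j hT₁ h01 hinv₁)) ?_
  have hA : MeasurableSet {z | T₂ z < t} := measurableSet_lt hT₂ measurable_const
  -- A missed label-`1` point either has `p`-value above `t` or occurs while `T₂ < t`. The latter
  -- event ignores observation `j`, so the factor `π₁` can be extracted.
  have hsub : {z | T (M.zeroedPValues ∅ z) < M.pValue (z j).1 ∧ (z j).2 = true} ⊆
      {z | z j ∈ {w : ℝ × Bool | t < M.pValue w.1 ∧ w.2 = true}} ∪
        ({z | T₂ z < t} ∩ {z | (z j).2 = true}) := by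
    rintro z ⟨h1, h2⟩
    rcases lt_or_ge (T₂ z) t with h | h
    · exact Or.inr ⟨h, h2⟩
    · exact Or.inl ⟨h.trans_lt (hneg z h1), h2⟩
  have h2 : MeasurableSet {w : ℝ × Bool | t < M.pValue w.1 ∧ w.2 = true} :=
    (measurableSet_lt measurable_const (measurable_pValue_fst hM)).inter
      (measurableSet_label true)
  refine (measureReal_mono hsub).trans ((measureReal_union_le _ _).trans ?_)
  rw [sampleLaw_real_coord hM j h2, pairLaw_real_falseNeg hM, mul_add]
  refine add_le_add le_rfl ((sampleLaw_label_true_le hM j hA fun z w => ?_).trans ?_)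
  · simp only [mem_ofPred_eq, hinv₂]
  · refine mul_le_mul_of_nonneg_left ?_ (prob1_pos hM).le
    exact (measureReal_mono fun z hz => (hle z).trans_lt hz).trans hδ

lemma errorProb_fdrThreshold_le (hM : M.Admissible) (hm : 0 < m) (hα : α ∈ Ioo (0 : ℝ) 1)
    {t δ : ℝ} (hδ : (M.sampleLaw (m + 1)).real
      {z | fdrThreshold α (M.zeroedPValues (∅ : Finset (Fin m)) z) < t} ≤ δ)
    (j : Fin (m + 1)) :
    M.errorProb (fun p : Fin m → ℝ => fdrThreshold α p) j ≤
      M.prob1 * (α / (1 - α)) + α / m / (1 - α) ^ 2 + M.prob1 * (1 - M.altCDF t + δ) := by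
  have hα' : α ∈ Ioc (0 : ℝ) 1 := ⟨hα.1, hα.2.le⟩
  have hα1 : 0 < 1 - α := sub_pos.2 hα.2
  have hm0 : (0 : ℝ) < m := by exact_mod_cast hm
  have hmeas : ∀ S : Finset (Fin m),
      Measurable fun z => bhThreshold α (M.zeroedPValues S z) := fun S =>
    (measurable_bhThreshold hα').comp (measurable_zeroedPValues hM S)
  have hsing : ∀ (i : Fin m) z, M.zeroedPValues {i} z =
      Function.update (M.zeroedPValues ∅ z) i 0 := fun i z => by
    rw [← zeroedPValues_insert, insert_empty_eq]
  have hval : ∀ (i : Fin m) z, M.zeroedPValues ∅ z i = M.pValue (z i.castSucc).1 :=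
    fun i z => by rw [zeroedPValues_empty]
  have hp0 : ∀ (i : Fin m) z, 0 ≤ M.zeroedPValues ∅ z i := fun i z => by
    rw [hval]
    exact (pValue_pos hM _).le
  have hI : ∀ i : Fin m, M.prob0 * ∫ z, bhThreshold α (M.zeroedPValues {i} z)
      ∂(M.sampleLaw (m + 1)) ≤ M.prob1 * (α / (1 - α)) + α / m / (1 - α) ^ 2 := by
    intro i
    have h1 := integral_bhThreshold_le hM hm hα {i}
    have h2 : 0 ≤ ∫ z, bhThreshold α (M.zeroedPValues {i} z) ∂(M.sampleLaw (m + 1)) :=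
      integral_nonneg fun z => (bhThreshold_mem_Icc _).1
    have h3 : M.prob0 ≤ 1 := by linarith [prob0_add_prob1 hM, prob1_pos hM]
    refine (mul_le_of_le_one_left h2 h3).trans (h1.trans_eq ?_)
    -- For one zeroed index, `1/(1-α) + α/(1-α)² = 1/(1-α)²`.
    rw [Finset.card_singleton]
    field_simp
    ring
  refine Fin.lastCases ?_ (fun i => ?_) j
  -- The sample threshold already ignores the new point. Zeroing an arbitrary index only serves to
  -- reuse the bound on the mean.
  · let i : Fin m := ⟨0, hm⟩
    refine (errorProb_le hM (hmeas {i}) (T₂ := fun z => fdrThreshold α (M.zeroedPValues ∅ z))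
      ((measurable_fdrThreshold hα').comp (measurable_zeroedPValues hM ∅))
      (fun z => bhThreshold_mem_Icc _) (fun z w => by rw [zeroedPValues_update_last])
      (fun z w => by rw [zeroedPValues_update_last]) (fun z => le_rfl) (fun z hz => ?_)
      (fun z hz => hz) hδ).trans (add_le_add (hI i) le_rfl)
    rw [hsing]
    exact hz.trans (fdrThreshold_le_update hα' (hp0 i z))
  · refine (errorProb_le hM (hmeas {i}) (hmeas {i})
      (fun z => bhThreshold_mem_Icc _)
      (fun z w => by rw [zeroedPValues_update (Finset.mem_singleton_self i)])
      (fun z w => by rw [zeroedPValues_update (Finset.mem_singleton_self i)])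
      (fun z => ?_) (fun z hz => ?_) (fun z hz => ?_) hδ).trans (add_le_add (hI i) le_rfl)
    · rw [hsing]
      exact fdrThreshold_le_update hα' (hp0 i z)
    · rw [hsing, ← hval i z]
      rw [← hval i z] at hz
      exact (le_fdrThreshold_iff_update hα' (hp0 i z)).1 hz
    · rw [hsing, ← hval i z, ← not_le, ← le_fdrThreshold_iff_update hα' (hp0 i z), not_le, hval]
      exact hz

lemma qOpt_mul (hM : M.Admissible) : M.qOpt * (M.τ * M.bayesThreshold) = M.bayesPower := by
  have h1 := (bayesThreshold_mem hM).1.ne'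
  have h2 : M.τ ≠ 0 := by linarith [hM.1]
  unfold qOpt psi bayesPower
  field_simp

lemma qOpt_pos (hM : M.Admissible) : 0 < M.qOpt := by
  have h1 := mul_pos (one_pos.trans hM.1) (bayesThreshold_mem hM).1
  have h2 := bayesPower_pos hM
  rw [← qOpt_mul hM] at h2
  exact pos_of_mul_pos_left h2 h1.le

/-- The condition on `r` is exactly that a fraction `ν` of the Bayes power survives the shrinking.
-/
lemma factor_mul_div_rate_le (hM : M.Admissible) {ν A : ℝ} (hν : ν < 1)
    (h : M.factor / (M.bayesPower * (1 - ν)) * A ≤ M.rate) :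
    M.factor * (A / M.rate) ≤ M.bayesPower * (1 - ν) := by
  have hr := (exists_threshold_of_shrink hM).1
  have hC : 0 < M.bayesPower * (1 - ν) := mul_pos (bayesPower_pos hM) (sub_pos.2 hν)
  rw [div_mul_eq_mul_div, div_le_iff₀ hC] at h
  rw [← mul_div_assoc, div_le_iff₀ hr]
  linarith

lemma bfdr_excess_le (hM : M.Admissible) (hα : α ∈ Ioo (0 : ℝ) (1 / 2)) {ν q : ℝ}
    (hν : ν ∈ Ioo (0 : ℝ) 1) (hq : q = α⁻¹ - 1)
    (h : M.factor / (M.bayesPower * (1 - ν)) * (Real.log (q / M.qOpt) - Real.log ν) ≤ M.rate) :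
    M.τ * (M.bfdrThreshold α - M.bayesThreshold) +
        (M.bayesPower - M.altCDF (M.bfdrThreshold α)) ≤
      max (M.bayesPower / q - M.bayesPower / M.qOpt)
        (M.factor * ((Real.log (q / M.qOpt) - Real.log ν) / M.rate)) := by
  obtain ⟨hmem, hpsi⟩ := bfdrThreshold_spec hM hα
  rw [← hq] at hpsi
  have h2 : 2 < α⁻¹ := (lt_inv_comm₀ two_pos hα.1).2 (by linarith [hα.2])
  have hq1 : 1 < q := by linarith
  have hq0 : 0 < q := by linarith
  have hτ : 0 < M.τ := one_pos.trans hM.1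
  have hB := bayesThreshold_mem hM
  have hopt := qOpt_pos hM
  have hCopt := qOpt_mul hM
  have hmono := monotone_altCDF hM
  set t := M.bfdrThreshold α
  have hF : M.altCDF t = q * (M.τ * t) := by
    unfold psi at hpsi
    rw [div_eq_iff hmem.1.ne'] at hpsi
    rw [hpsi, mul_assoc]
  have e1 : M.bayesPower / M.qOpt = M.τ * M.bayesThreshold := by
    rw [← hCopt, mul_div_cancel_left₀ _ hopt.ne']
  rcases le_or_gt M.bayesThreshold t with hle | hlt
  · refine le_max_of_le_left ?_
    have hCF : M.bayesPower ≤ q * (M.τ * t) := hF ▸ hmono hle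
    have h3 : M.τ * t - M.bayesPower / q = (q * (M.τ * t) - M.bayesPower) / q := by
      field_simp
    have h4 : (q * (M.τ * t) - M.bayesPower) / q ≤ q * (M.τ * t) - M.bayesPower :=
      div_le_self (sub_nonneg.2 hCF) hq1.le
    rw [e1, hF]
    linarith
  · refine le_max_of_le_right ?_
    have hqq : M.qOpt ≤ q := by
      have h3 := (strictAntiOn_psi hM hmem hB hlt).le
      rw [hpsi] at h3
      unfold qOpt
      rw [inv_mul_le_iff₀ hτ]
      linarith
    have hA : 0 ≤ Real.log (q / M.qOpt) - Real.log ν := by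
      have h3 := Real.log_nonneg ((one_le_div hopt).2 hqq)
      have h4 := Real.log_nonpos hν.1.le hν.2.le
      linarith
    obtain ⟨hr, hK, hshrink⟩ := exists_threshold_of_shrink hM
    obtain ⟨s, hs, hsle, hsF⟩ := hshrink _ hA
    have hexp : Real.exp (-(Real.log (q / M.qOpt) - Real.log ν)) = ν * (M.qOpt / q) := by
      rw [← Real.log_div (div_pos hq0 hopt).ne' hν.1.ne', ← Real.log_inv,
        Real.exp_log (by have := hν.1; positivity)]
      field_simp
    rw [hexp] at hsle
    have hloss := factor_mul_div_rate_le hM hν.2 h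
    -- At `s` the power is at least `ν C`, while `q τ s ≤ ν C`; thus `Ψ(s) ≥ q τ = Ψ(t)`.
    have hst : s ≤ t := by
      by_contra! hts
      have h3 := strictAntiOn_psi hM hmem hs hts
      rw [hpsi] at h3
      unfold psi at h3
      rw [div_lt_iff₀ hs.1] at h3
      have h4 := mul_le_mul_of_nonneg_left hsle (mul_pos hq0 hτ).le
      have h5 : q * M.τ * (M.bayesThreshold * (ν * (M.qOpt / q))) = ν * M.bayesPower := by
        rw [← hCopt]
        field_simp
      linarith
    have h6 := hmono hst
    have h7 := mul_le_mul_of_nonneg_left hlt.le hτ.le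
    rw [mul_sub]
    linarith

/-- The identity `q^opt τ t^B = C` eliminates the Bayes threshold. Writing `D` as `-log y` covers
both deviation terms. -/
lemma exp_neg_log_div_qOpt (hM : M.Admissible) (hα : 0 < α) {D y : ℝ} (hy : 0 < y)
    (hD : D = -Real.log y) :
    M.bayesThreshold * Real.exp (-(Real.log (α⁻¹ / M.qOpt) + D)) =
      α * y * M.bayesPower / M.τ := by
  have hopt := qOpt_pos hM
  have hτ : 0 < M.τ := one_pos.trans hM.1
  have hx : 0 < α⁻¹ / M.qOpt := div_pos (inv_pos.2 hα) hopt
  rw [hD, ← sub_eq_add_neg, neg_sub, Real.exp_sub, Real.exp_log hy, Real.exp_log hx,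
    ← qOpt_mul hM]
  field_simp

/-- A threshold that loses little power and that the FDR threshold exceeds with high
probability. -/
lemma exists_threshold_le_fdrThreshold (hM : M.Admissible) (hm : 0 < m)
    (hα : α ∈ Ioo (0 : ℝ) 1) {ν ε : ℝ} (hν : ν ∈ Ioo (0 : ℝ) 1) (hε : ε ∈ Ioo (0 : ℝ) 1)
    {a : ℕ} (h : M.factor / (M.bayesPower * (1 - ν)) *
      (Real.log (α⁻¹ / M.qOpt) + M.devTerm m ν ε a) ≤ M.rate) :
    ∃ t, M.bayesPower - M.factor *
        (max (Real.log (α⁻¹ / M.qOpt) + M.devTerm m ν ε a) 0 / M.rate) ≤ M.altCDF t ∧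
      (M.sampleLaw (m + 1)).real
        {z | fdrThreshold α (M.zeroedPValues (∅ : Finset (Fin m)) z) < t} ≤
      if a = 1 then Real.exp (-(m * (M.τ + 1)⁻¹ * ν * ε ^ 2 * M.bayesPower / 4)) else 0 := by
  have := isProbabilityMeasure_pairLaw hM
  obtain ⟨hr, hK, hshrink⟩ := exists_threshold_of_shrink hM
  have hC := bayesPower_pos hM
  have hτ : 0 < M.τ := one_pos.trans hM.1
  have hm0 : (0 : ℝ) < m := by exact_mod_cast hm
  have hα0 := hα.1
  have hν0 := hν.1
  set A := Real.log (α⁻¹ / M.qOpt) + M.devTerm m ν ε a with hAdef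
  -- `A` may be negative, whereas only shrinking is allowed; hence the positive part in the bound.
  obtain ⟨t, ht, htle, htF⟩ := hshrink (max A 0) (le_max_right _ _)
  refine ⟨t, htF, ?_⟩
  have htA : t ≤ M.bayesThreshold * Real.exp (-A) := by
    refine htle.trans (mul_le_mul_of_nonneg_left ?_ (bayesThreshold_mem hM).1.le)
    exact Real.exp_le_exp.2 (neg_le_neg (le_max_left _ _))
  split_ifs with ha
  · have hε1 : 0 < 1 - ε := sub_pos.2 hε.2
    have hπ1 := prob1_pos hM
    have hπ0 : 0 < M.prob0 := M.prob0_eq ▸ mul_pos hτ hπ1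
    have hloss : M.factor * (max A 0 / M.rate) ≤ M.bayesPower * (1 - ν) := by
      refine factor_mul_div_rate_le hM hν.2 ?_
      rcases le_total A 0 with h0 | h0
      · rw [max_eq_right h0, mul_zero]
        exact hr.le
      · rw [max_eq_left h0]
        exact h
    rw [hAdef, exp_neg_log_div_qOpt hM hα0 (y := ν * M.prob0 * (1 - ε)) (by positivity)
      (by simp [devTerm, ha]), M.prob0_eq] at htA
    -- `D₁` is chosen so that `t / α` is at most `1 - ε` times `π₁ ν C`, a lower bound for the mean
    -- of `Ĝ(t)`; the Chernoff bound then makes `t` feasible for BH.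
    have htc : t ≤ α * ((1 - ε) * (M.prob1 * (ν * M.bayesPower))) := by
      refine htA.trans_eq ?_
      field_simp
    have hc : M.prob1 * (ν * M.bayesPower) ≤ M.pairLaw.real {w | M.pValue w.1 ≤ t} := by
      rw [pairLaw_real_pValue_le hM]
      have h1 : 0 ≤ M.prob0 * M.nullLaw.real {x | M.pValue x ≤ t} :=
        mul_nonneg hπ0.le measureReal_nonneg
      have h2 : ν * M.bayesPower ≤ M.altCDF t := by linarith
      have h3 := mul_le_mul_of_nonneg_left h2 hπ1.le
      linarith
    refine (measureReal_mono ?_).trans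
      ((sampleLaw_empCDF_le (m := m) hM hε.1.le hc hε.2.le).trans ?_)
    · intro z hz
      have hz' : fdrThreshold α (fun i : Fin m => M.pValue (z i.castSucc).1) < t := by
        rw [← zeroedPValues_empty]
        exact hz
      change empCDF _ t ≤ _
      by_contra! hcon
      refine hz'.not_ge (le_trans (le_bhThreshold (Ioo_subset_Icc_self ht) ?_)
        (le_max_left _ _))
      exact ((div_le_iff₀' hα0).2 htc).trans hcon.le
    · rw [Real.exp_le_exp, neg_le_neg_iff]
      have e : M.prob1 = (M.τ + 1)⁻¹ := by
        unfold prob1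
        rw [one_div, add_comm]
      rw [← e]
      have hpos : 0 ≤ m * M.prob1 * ν * ε ^ 2 * M.bayesPower := by positivity
      linarith
  · rw [hAdef, exp_neg_log_div_qOpt hM hα0 (y := (ν⁻¹ * M.bayesPower * M.τ⁻¹ * m)⁻¹)
      (by positivity) (by rw [Real.log_inv, neg_neg, devTerm, if_neg ha])] at htA
    -- `D₂` is chosen so that the shrunk threshold is at most `ν α / m`, below the Bonferroni floor
    -- for every sample.
    have htm : t ≤ α / m := by
      have e : α * (ν⁻¹ * M.bayesPower * M.τ⁻¹ * m)⁻¹ * M.bayesPower / M.τ = ν * (α / m) := by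
        field_simp
      rw [e] at htA
      exact htA.trans (mul_le_of_le_one_left (by positivity) hν.2.le)
    have hempty : {z | fdrThreshold α (M.zeroedPValues (∅ : Finset (Fin m)) z) < t} = ∅ := by
      ext z
      have hz : t ≤ fdrThreshold α (M.zeroedPValues ∅ z) := htm.trans (le_max_right _ _)
      simpa using hz
    rw [hempty, measureReal_empty]

end Model

end SubbotinFDR

theorem corollary4p2 {Ω : Type*} [MeasurableSpace Ω] (P : Measure Ω) [IsProbabilityMeasure P]
    (M : Model) (hM : M.Admissible) (m : ℕ) (hm : 2 ≤ m)
    (X : Fin (m + 1) → Ω → ℝ) (H : Fin (m + 1) → Ω → Bool) (hXH : IsSample P M X H)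
    (R : RiskKind) (α : ℝ) (hα : α ∈ Ioo (0 : ℝ) (1 / 2)) (ν : ℝ) (hν : ν ∈ Ioo (0 : ℝ) 1) :
    (∀ q : ℝ, q = α⁻¹ - 1 →
      M.rate ≥ M.factor / (M.bayesPower * (1 - ν)) * (Real.log (q / M.qOpt) - Real.log ν) →
      risk P M X H R (fun _ => M.bfdrThreshold α) - risk P M X H R (fun _ => M.bayesThreshold)
        ≤ M.prob1 * max (M.bayesPower / q - M.bayesPower / M.qOpt)
            (M.factor * ((Real.log (q / M.qOpt) - Real.log ν) / M.rate))) ∧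
    (∀ ε ∈ Ioo (0 : ℝ) 1, ∀ a ∈ ({1, 2} : Finset ℕ),
      M.rate ≥ M.factor / (M.bayesPower * (1 - ν)) *
          (Real.log (α⁻¹ / M.qOpt) + M.devTerm m ν ε a) →
      risk P M X H R (fdrThreshold α) - risk P M X H R (fun _ => M.bayesThreshold)
        ≤ M.prob1 * (α / (1 - α) +
              M.factor * (max (Real.log (α⁻¹ / M.qOpt) + M.devTerm m ν ε a) 0 / M.rate))
          + (α / m) / (1 - α) ^ 2
          + M.prob1 * (if a = 1 then
              Real.exp (-(m * (M.τ + 1)⁻¹ * ν * ε ^ 2 * M.bayesPower / 4)) else 0)) := by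
  have hm0 : 0 < m := by omega
  have hB := Model.bayesThreshold_mem hM
  have hα1 : α ∈ Ioo (0 : ℝ) 1 := ⟨hα.1, by linarith [hα.2]⟩
  have hπ1 := Model.prob1_pos hM
  have hRB : risk P M X H R (fun _ => M.bayesThreshold) =
      M.prob0 * M.bayesThreshold + M.prob1 * (1 - M.bayesPower) :=
    Model.risk_const hM hm0 hXH R hB
  refine ⟨fun q hq h => ?_, fun ε hε a _ h => ?_⟩
  · rw [hRB, Model.risk_const hM hm0 hXH R (Model.bfdrThreshold_spec hM hα).1, M.prob0_eq]
    refine le_trans (le_of_eq ?_)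
      (mul_le_mul_of_nonneg_left (Model.bfdr_excess_le hM hα hν hq h) hπ1.le)
    ring
  · obtain ⟨t, htF, hδ⟩ := Model.exists_threshold_le_fdrThreshold hM hm0 hα1 hν hε h
    have h1 := Model.risk_le_of_errorProb_le hM hm0 hXH
      (measurable_fdrThreshold ⟨hα1.1, hα1.2.le⟩) R
      (Model.errorProb_fdrThreshold_le hM hm0 hα1 hδ)
    change risk P M X H R (fdrThreshold α) ≤ _ at h1
    have h2 := mul_le_mul_of_nonneg_left htF hπ1.le
    -- The Bayes false positives `π₀ t^B`, which are subtracted, are simply discarded.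
    have h3 := mul_nonneg (Model.prob0_nonneg hM) hB.1.le
    rw [hRB]
    linarith
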